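/- Let $A$ be a finite alphabet, let $n,m\in\mathbb{N}$, let $D=\{1,\ldots,n\}\times\{1,\ldots,m\}\subset\mathbb{Z}^2$, and let $P\subseteq A^D$ be a set of $D$-patterns over $A$ (the allowed patterns). For $c\in A^{\mathbb{Z}^2}$ and $\vec{t}\in\mathbb{Z}^2$ let $\tau^{\vec{t}}(c)\in A^{\mathbb{Z}^2}$ be the translate given by $\tau^{\vec{t}}(c)_{\vec{n}}=c_{\vec{n}-\vec{t}}$, and let $$X=\{c\in A^{\mathbb{Z}^2}\ |\ \tau^{\vec{t}}(c)|_D\in P \text{ for all } \vec{t}\in\mathbb{Z}^2\}$$ be the subshift of finite type of all configurations whose $D$-patterns are all in $P$. If $|P|\leq nm$ and $X\neq\emptyset$, then $X$ contains a periodic configuration, that is, there are $c\in X$ and a non-zero vector $\vec{t}\in\mathbb{Z}^2$ such that $\tau^{\vec{t}}(c)=c$. -/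

import Mathlib

namespace LowComplexity

/-- A two-dimensional configuration over the alphabet `A`: a colouring of `ℤ²`. -/
abbrev Configuration (A : Type*) := ℤ × ℤ → A

/-- The translation `τ^t`, given by `τ^t(c)_n = c_{n - t}`. -/
def translate {A : Type*} (t : ℤ × ℤ) (c : Configuration A) : Configuration A :=
  fun n => c (n - t)

/-- `c` is periodic if it is fixed by the translation by some non-zero vector. -/
def IsPeriodic {A : Type*} (c : Configuration A) : Prop :=
  ∃ t : ℤ × ℤ, t ≠ 0 ∧ translate t c = c

/-- A `D`-pattern is a colouring of the finite domain `D ⊆ ℤ²`. -/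
abbrev Pattern (A : Type*) (D : Finset (ℤ × ℤ)) := D → A

/-- The `D`-pattern `c|_D`. -/
def restrict {A : Type*} (D : Finset (ℤ × ℤ)) (c : Configuration A) : Pattern A D :=
  fun d => c d

/-- The set of the `D`-patterns that appear in `c`, that is, of all `τ^t(c)|_D`. -/
def patterns {A : Type*} (c : Configuration A) (D : Finset (ℤ × ℤ)) : Set (Pattern A D) :=
  Set.range fun t : ℤ × ℤ => restrict D (translate t c)

/-- The rectangle `{1, …, n} × {1, …, m}`. -/
noncomputable def rectangle (n m : ℕ) : Finset (ℤ × ℤ) :=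
  Finset.Icc (1 : ℤ) n ×ˢ Finset.Icc (1 : ℤ) m

/-- The set of configurations all of whose `D`-patterns are in the set `P` of allowed patterns. -/
def allowedSFT {A : Type*} {D : Finset (ℤ × ℤ)} (P : Set (Pattern A D)) :
    Set (Configuration A) :=
  {c | patterns c D ⊆ P}

/-- Equivalently, no translate of `c` lies in the cylinder of a `D`-pattern outside `P`. -/
theorem mem_allowedSFT_iff_forbidden {A : Type*} {D : Finset (ℤ × ℤ)} (P : Set (Pattern A D))
    (c : Configuration A) :
    c ∈ allowedSFT P ↔ ∀ t : ℤ × ℤ, ∀ p ∈ Pᶜ, restrict D (translate t c) ≠ p := by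
  constructor
  · rintro h t p hp rfl
    exact hp (h ⟨t, rfl⟩)
  · rintro h _ ⟨t, rfl⟩
    by_contra hp
    exact h t _ hp rfl

end LowComplexity

/-! Code the letters by distinct integers. As $|P|\le|D|$, some non-trivial integer combination of
the cells of $D$ is constant on $P$, and one more difference turns it into a non-zero Laurent
polynomial annihilating all of $X$. Configurations are bounded, so a Frobenius argument modulo large
primes upgrades this to an annihilator $\prod_v (X^v-1)$ with all $v\ne 0$, the same for all of $X$
(`exists_diffs_eq_zero_of_ncard_le`).

Pass to a minimal subshift $Y\subseteq X$; if $Y$ is finite, periods are immediate. Otherwise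
compactness yields two elements of $Y$ that differ at the origin but agree on an open half-plane
(`exists_ne_agree_on_halfPlane`). The annihilator forces some $v$ to be parallel to the boundary,
and makes the difference of the two configurations periodic in that direction. In a suitable basis
of the lattice the boundary is horizontal. By minimality there is then also a pair agreeing on the
opposite half-plane (`exists_pair_agree_above`).

Now take a smallest convex $B$ with at most $|B|$ patterns in $Y$, reflected if necessary so that
its top row, of $m+1$ cells, is no longer than its bottom row. Minimality of $B$ leaves at most $m$
patterns of the lower rows that extend to the top row in several ways, and each lower row contains
$m$ consecutive cells. Where the extension is never unique, the Morse–Hedlund theorem makes the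
lower rows periodic. This periodicity spreads upward with a fixed period
(`Generator.exists_periodic`), and a limit of translates is periodic everywhere. -/

namespace LowComplexity

/-! ### Annihilators and products of differences -/

/-- Laurent polynomials act on functions `ℤ² → ℤ`, the monomial `X^v` as the shift by `v`. -/
noncomputable def laurentAction :
    AddMonoidAlgebra ℤ (ℤ × ℤ) →ₐ[ℤ] Module.End ℤ (ℤ × ℤ → ℤ) :=
  AddMonoidAlgebra.lift ℤ _ _
    { toFun := fun v => LinearMap.funLeft ℤ ℤ (fun p => p + v.toAdd)
      map_one' := by ext g p; simp [LinearMap.funLeft]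
      map_mul' := by
        intro v w; ext g p
        simp only [LinearMap.funLeft, toAdd_mul, LinearMap.coe_mk, AddHom.coe_mk,
          Module.End.mul_apply, Function.comp_apply]
        congr 1; abel }

theorem laurentAction_single (v : ℤ × ℤ) (a : ℤ) (g : ℤ × ℤ → ℤ) (p : ℤ × ℤ) :
    laurentAction (AddMonoidAlgebra.single v a) g p = a * g (p + v) := by
  simp [laurentAction, LinearMap.funLeft]

theorem laurentAction_sum_single {ι : Type*} (s : Finset ι) (w : ι → ℤ × ℤ) (a : ι → ℤ)
    (g : ℤ × ℤ → ℤ) (p : ℤ × ℤ) :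
    laurentAction (∑ i ∈ s, AddMonoidAlgebra.single (w i) (a i)) g p
      = ∑ i ∈ s, a i * g (p + w i) := by
  rw [map_sum, LinearMap.sum_apply, Finset.sum_apply]
  exact Finset.sum_congr rfl fun i _ => laurentAction_single _ _ _ _

theorem laurentAction_mul (f h : AddMonoidAlgebra ℤ (ℤ × ℤ)) (g : ℤ × ℤ → ℤ) :
    laurentAction (f * h) g = laurentAction f (laurentAction h g) := by
  rw [map_mul]; rfl

theorem laurentAction_eq_zero_of_dvd {f h : AddMonoidAlgebra ℤ (ℤ × ℤ)} (hfh : f ∣ h)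
    {g : ℤ × ℤ → ℤ} (hg : laurentAction f g = 0) : laurentAction h g = 0 := by
  obtain ⟨k, rfl⟩ := hfh
  rw [mul_comm, laurentAction_mul, hg, map_zero]

/-- Frobenius: modulo $p$ the $p$-th power is additive, and by Fermat it fixes integer coefficients,
so $f(X)^p\equiv f(X^p)$. -/
theorem sum_single_pow_prime {ι : Type*} (s : Finset ι) (w : ι → ℤ × ℤ) (a : ι → ℤ)
    {p : ℕ} (hp : p.Prime) :
    ∃ h : AddMonoidAlgebra ℤ (ℤ × ℤ),
      (∑ i ∈ s, AddMonoidAlgebra.single (w i) (a i)) ^ p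
        = ∑ i ∈ s, AddMonoidAlgebra.single (p • w i) (a i) + (p : AddMonoidAlgebra ℤ (ℤ × ℤ)) * h := by
  classical
  induction s using Finset.induction_on with
  | empty => exact ⟨0, by simp [hp.ne_zero]⟩
  | insert i s hi ih =>
    obtain ⟨h, hh⟩ := ih
    rw [Finset.sum_insert hi, Finset.sum_insert hi]
    obtain ⟨r, hr⟩ := exists_add_pow_prime_eq hp (AddMonoidAlgebra.single (w i) (a i))
      (∑ i ∈ s, AddMonoidAlgebra.single (w i) (a i))
    have hdvd : (p : ℤ) ∣ a i ^ p - a i := by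
      have := Fact.mk hp
      rw [← ZMod.intCast_zmod_eq_zero_iff_dvd]
      push_cast
      rw [ZMod.pow_card, sub_self]
    obtain ⟨k, hk⟩ := hdvd
    have h1 : (AddMonoidAlgebra.single (w i) (a i) : AddMonoidAlgebra ℤ (ℤ × ℤ)) ^ p
        = AddMonoidAlgebra.single (p • w i) (a i)
          + (p : AddMonoidAlgebra ℤ (ℤ × ℤ)) * AddMonoidAlgebra.single (p • w i) k := by
      rw [AddMonoidAlgebra.single_pow, ← nsmul_eq_mul, AddMonoidAlgebra.smul_single,
        ← AddMonoidAlgebra.single_add]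
      congr 1
      rw [nsmul_eq_mul]; linarith
    rw [hr, hh, h1]
    refine ⟨AddMonoidAlgebra.single (p • w i) k + h + AddMonoidAlgebra.single (w i) (a i) *
      (∑ i ∈ s, AddMonoidAlgebra.single (w i) (a i)) * r, ?_⟩
    ring

/-- Since $f^p$ annihilates $g$, every value of $f(X^p)g$ is divisible by $p$; these values are at
most $C\sum|a_i|<p$ in absolute value, hence zero. -/
theorem laurentAction_dilate_prime {ι : Type*} (s : Finset ι) (w : ι → ℤ × ℤ) (a : ι → ℤ)
    {g : ℤ × ℤ → ℤ} {C : ℤ} (hC : ∀ p, |g p| ≤ C) {p : ℕ} (hp : p.Prime)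
    (hlt : C * ∑ i ∈ s, |a i| < p)
    (h0 : laurentAction (∑ i ∈ s, AddMonoidAlgebra.single (w i) (a i)) g = 0) :
    laurentAction (∑ i ∈ s, AddMonoidAlgebra.single (p • w i) (a i)) g = 0 := by
  obtain ⟨h, hh⟩ := sum_single_pow_prime s w a hp
  have h1 := laurentAction_eq_zero_of_dvd (dvd_pow_self _ hp.ne_zero) h0
  rw [hh, map_add, LinearMap.add_apply, laurentAction_mul] at h1
  funext q
  have h2 := congrFun h1 q
  rw [Pi.add_apply, map_natCast, Module.End.natCast_apply, Pi.smul_apply, nsmul_eq_mul,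
    Pi.zero_apply] at h2
  rw [Pi.zero_apply]
  apply Int.eq_zero_of_abs_lt_dvd (m := (p : ℤ))
  · exact ⟨-laurentAction h g q, by linarith⟩
  · rw [laurentAction_sum_single]
    refine lt_of_le_of_lt (Finset.abs_sum_le_sum_abs _ _) (lt_of_le_of_lt ?_ hlt)
    rw [Finset.mul_sum]
    refine Finset.sum_le_sum fun i _ => ?_
    rw [abs_mul, mul_comm]
    exact mul_le_mul_of_nonneg_right (hC _) (abs_nonneg _)

/-- Dilation leaves the coefficients alone, so the same bound on primes serves for each prime factor
of $r$ in turn. -/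
theorem laurentAction_dilate {ι : Type*} (s : Finset ι) (w : ι → ℤ × ℤ) (a : ι → ℤ)
    {g : ℤ × ℤ → ℤ} {C : ℤ} (hC : ∀ p, |g p| ≤ C)
    (h0 : laurentAction (∑ i ∈ s, AddMonoidAlgebra.single (w i) (a i)) g = 0)
    (r : ℕ) (hr0 : r ≠ 0) (hr : ∀ p : ℕ, p.Prime → p ∣ r → C * ∑ i ∈ s, |a i| < p) :
    laurentAction (∑ i ∈ s, AddMonoidAlgebra.single (r • w i) (a i)) g = 0 := by
  induction r using induction_on_primes with
  | zero => exact absurd rfl hr0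
  | one => simpa using h0
  | prime_mul p r hp ih =>
    have hr' : r ≠ 0 := right_ne_zero_of_mul hr0
    have h1 := ih hr' fun q hq hqr => hr q hq (hqr.mul_left p)
    have h2 := laurentAction_dilate_prime s (fun i => r • w i) a hC hp
      (hr p hp (dvd_mul_right p r)) h1
    simpa only [smul_smul] using h2

/-- With $y_v=X^{Mv}$, the hypothesis says that $\sum_v a_vX^v y_v^j$ annihilates $g$ for every $j$.
Combining these with the coefficients of a polynomial $q$ gives $\sum_v a_vX^v q(y_v)$; choosing $q$
to vanish at all $y_l$ with $l\ne i$ isolates the term of $i$. -/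
theorem laurentAction_prod_eq_zero (s : Finset (ℤ × ℤ)) (a : ℤ × ℤ → ℤ)
    {g : ℤ × ℤ → ℤ} {M : ℕ}
    (h : ∀ j : ℕ, laurentAction (∑ v ∈ s, AddMonoidAlgebra.single ((1 + j * M) • v) (a v)) g = 0)
    {i : ℤ × ℤ} (hi : i ∈ s) (hai : a i ≠ 0) :
    laurentAction (∏ l ∈ s.erase i, (AddMonoidAlgebra.single (M • i) 1
      - AddMonoidAlgebra.single (M • l) 1)) g = 0 := by
  classical
  set y : ℤ × ℤ → AddMonoidAlgebra ℤ (ℤ × ℤ) := fun l => AddMonoidAlgebra.single (M • l) 1 with hy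
  set q : Polynomial (AddMonoidAlgebra ℤ (ℤ × ℤ)) :=
    ∏ l ∈ s.erase i, (Polynomial.X - Polynomial.C (y l)) with hq
  have hqe : ∀ v, q.eval (y v) = ∏ l ∈ s.erase i, (y v - y l) := by
    intro v; simp [hq, Polynomial.eval_prod]
  have key : ∑ j ∈ Finset.range (q.natDegree + 1), q.coeff j *
      (∑ v ∈ s, AddMonoidAlgebra.single ((1 + j * M) • v) (a v))
      = AddMonoidAlgebra.single i (a i) * ∏ l ∈ s.erase i, (y i - y l) := by
    have hs : ∀ (j : ℕ) v, (AddMonoidAlgebra.single ((1 + j * M) • v) (a v)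
        : AddMonoidAlgebra ℤ (ℤ × ℤ)) = AddMonoidAlgebra.single v (a v) * y v ^ j := by
      intro j v
      rw [hy, AddMonoidAlgebra.single_pow, AddMonoidAlgebra.single_mul_single, one_pow, mul_one,
        smul_smul, add_smul, one_smul]
    calc _ = ∑ v ∈ s, AddMonoidAlgebra.single v (a v) * q.eval (y v) := by
          simp_rw [Finset.mul_sum]
          rw [Finset.sum_comm]
          refine Finset.sum_congr rfl fun v _ => ?_
          rw [Polynomial.eval_eq_sum_range, Finset.mul_sum]
          refine Finset.sum_congr rfl fun j _ => ?_
          rw [hs]; ring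
      _ = AddMonoidAlgebra.single i (a i) * q.eval (y i) := by
          refine Finset.sum_eq_single_of_mem i hi fun v hv hvi => ?_
          rw [hqe, Finset.prod_eq_zero (f := fun l => y v - y l) (Finset.mem_erase.2 ⟨hvi, hv⟩)
              (sub_self _), mul_zero]
      _ = _ := by rw [hqe]
  have h1 : laurentAction (AddMonoidAlgebra.single i (a i) * ∏ l ∈ s.erase i, (y i - y l)) g = 0 := by
    rw [← key, map_sum, LinearMap.sum_apply]
    refine Finset.sum_eq_zero fun j _ => ?_
    rw [laurentAction_mul, h j, map_zero]
  funext p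
  rw [laurentAction_mul] at h1
  have h2 := congrFun h1 (p - i)
  rw [laurentAction_single, sub_add_cancel] at h2
  exact (mul_eq_zero.1 h2).resolve_left hai

/-- The difference operator in direction `v`. -/
def diff (v : ℤ × ℤ) (g : ℤ × ℤ → ℤ) : ℤ × ℤ → ℤ := fun p => g (p + v) - g p

/-- The composition of the difference operators of the vectors in a list. -/
def diffs (L : List (ℤ × ℤ)) (g : ℤ × ℤ → ℤ) : ℤ × ℤ → ℤ := L.foldr diff g

theorem diffs_eq_laurentAction (L : List (ℤ × ℤ)) (g : ℤ × ℤ → ℤ) :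
    diffs L g = laurentAction
      (L.map fun v => (AddMonoidAlgebra.single v 1 - 1 : AddMonoidAlgebra ℤ (ℤ × ℤ))).prod g := by
  induction L with
  | nil => simp [diffs]
  | cons v L ih =>
    rw [List.map_cons, List.prod_cons, laurentAction_mul, ← ih]
    funext p
    simp [diffs, diff, laurentAction_single]

theorem exists_diffs_eq_zero (s : Finset (ℤ × ℤ)) (a : ℤ × ℤ → ℤ) (hs : ∃ i ∈ s, a i ≠ 0) (C : ℤ) :
    ∃ L : List (ℤ × ℤ), 0 ∉ L ∧ ∀ g : ℤ × ℤ → ℤ, (∀ p, |g p| ≤ C) →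
      laurentAction (∑ v ∈ s, AddMonoidAlgebra.single v (a v)) g = 0 → diffs L g = 0 := by
  classical
  obtain ⟨i, hi, hai⟩ := hs
  set N : ℕ := (C * ∑ v ∈ s, |a v|).toNat with hN
  -- Every prime up to $N$ divides $M$, so $1+jM$ has only prime factors above $N$, as the dilation
  -- lemma requires.
  set M : ℕ := N.factorial with hM
  have hM0 : M ≠ 0 := Nat.factorial_ne_zero N
  refine ⟨(s.erase i).toList.map fun l => M • (i - l), ?_, ?_⟩
  · simp only [List.mem_map, Finset.mem_toList, Finset.mem_erase, not_exists, not_and, and_imp]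
    intro l hli _ h
    rw [smul_eq_zero, or_iff_right hM0, sub_eq_zero] at h
    exact hli h.symm
  · intro g hC h0
    have h1 := laurentAction_prod_eq_zero s a (g := g) (M := M) (fun j => by
      refine laurentAction_dilate s id a hC h0 (1 + j * M) (by omega) fun p hp hpd => ?_
      by_contra hlt
      have hpN : p ≤ N := by omega
      have hpM : p ∣ M := hp.dvd_factorial.2 hpN
      have : p ∣ 1 := (Nat.dvd_add_left (hpM.mul_left j)).1 hpd
      exact hp.one_lt.ne' (Nat.dvd_one.1 this)) hi hai
    rw [diffs_eq_laurentAction, List.map_map, Finset.prod_map_toList]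
    refine laurentAction_eq_zero_of_dvd ?_ h1
    refine Finset.prod_dvd_prod_of_dvd _ _ fun l _ => ?_
    refine ⟨AddMonoidAlgebra.single (-(M • l)) 1, ?_⟩
    rw [sub_mul, AddMonoidAlgebra.single_mul_single, AddMonoidAlgebra.single_mul_single,
      add_neg_cancel, AddMonoidAlgebra.one_def, mul_one, Function.comp_apply, smul_sub,
      sub_eq_add_neg (M • i)]

/-- Being constant on $P$ means orthogonality to the differences with a fixed $p_0$: at most $|D|-1$
homogeneous equations in $|D|$ unknowns. -/
theorem exists_int_linear_relation {A : Type*} [Finite A] (ι : A → ℤ) {D : Finset (ℤ × ℤ)}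
    (P : Set (Pattern A D)) (hP : P.ncard ≤ D.card) (hne : P.Nonempty) :
    ∃ (a : ℤ × ℤ → ℤ) (κ : ℤ), (∃ d ∈ D, a d ≠ 0) ∧
      ∀ p ∈ P, ∑ d : D, a d * ι (p d) = κ := by
  classical
  obtain ⟨p₀, hp₀⟩ := hne
  have hfin : P.Finite := P.toFinite
  set Q : Finset (Pattern A D) := hfin.toFinset.erase p₀ with hQ
  have hcard : Fintype.card Q < Fintype.card D := by
    have h1 : hfin.toFinset.card = P.ncard := (Set.ncard_eq_toFinset_card P hfin).symm
    have h2 := Finset.card_erase_lt_of_mem (hfin.mem_toFinset.2 hp₀)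
    rw [← hQ] at h2
    simp only [Fintype.card_coe]
    omega
  let F : (D → ℤ) →ₗ[ℤ] (Q → ℤ) :=
    { toFun := fun a p => ∑ d : D, a d * (ι (p.1 d) - ι (p₀ d))
      map_add' := by
        intro a b; funext p
        simp [add_mul, Finset.sum_add_distrib]
      map_smul' := by
        intro k a; funext p
        simp [Finset.mul_sum, mul_assoc] }
  have hF : ¬ Function.Injective F := fun h => by
    have := card_le_of_injective ℤ F h
    omega
  rw [← LinearMap.ker_eq_bot, Submodule.eq_bot_iff] at hF
  push Not at hF
  obtain ⟨a, ha, ha0⟩ := hF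
  obtain ⟨d, hd⟩ := Function.ne_iff.1 ha0
  refine ⟨fun v => if h : v ∈ D then a ⟨v, h⟩ else 0, ∑ d : D, a d * ι (p₀ d), ⟨d, d.2, ?_⟩, ?_⟩
  · simpa using hd
  · intro p hp
    simp only [Subtype.coe_eta, Finset.coe_mem, dite_true]
    by_cases hpp : p = p₀
    · rw [hpp]
    · have h1 := congrFun (LinearMap.mem_ker.1 ha) ⟨p, Finset.mem_erase.2
        ⟨hpp, hfin.mem_toFinset.2 hp⟩⟩
      have h2 : ∑ d : D, a d * (ι (p d) - ι (p₀ d)) = 0 := h1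
      simp only [mul_sub, Finset.sum_sub_distrib] at h2
      linarith

/-- Configurations with few patterns have a common annihilator that is a product of differences. -/
theorem exists_diffs_eq_zero_of_ncard_le {A : Type*} [Finite A] (ι : A → ℤ) {D : Finset (ℤ × ℤ)}
    (P : Set (Pattern A D)) (hP : P.ncard ≤ D.card) :
    ∃ L : List (ℤ × ℤ), 0 ∉ L ∧ ∀ c ∈ allowedSFT P, diffs L (fun p => ι (c p)) = 0 := by
  classical
  rcases P.eq_empty_or_nonempty with rfl | hne
  · refine ⟨[], by simp, fun c hc => ?_⟩
    exact absurd (hc ⟨0, rfl⟩) (Set.notMem_empty _)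
  obtain ⟨a, κ, ⟨d₀, hd₀, had₀⟩, hκ⟩ := exists_int_linear_relation ι P hP hne
  set f : AddMonoidAlgebra ℤ (ℤ × ℤ) := ∑ d ∈ D, AddMonoidAlgebra.single d (a d) with hf
  have hf0 : f ≠ 0 := by
    intro h
    have h1 := congrArg (fun f => AddMonoidAlgebra.coeff f d₀) h
    simp [hf, Finsupp.single_apply, hd₀, had₀] at h1
  -- The relation $f$ only yields the constant $\kappa$; the factor $X^{(1,0)}-1$ kills it, and the
  -- product stays non-zero because the ring is a domain.
  set x : AddMonoidAlgebra ℤ (ℤ × ℤ) := AddMonoidAlgebra.single (1, 0) 1 - 1 with hx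
  have hx0 : x ≠ 0 := by
    intro h
    have h1 := congrArg (fun f => AddMonoidAlgebra.coeff f (1, 0)) h
    simp [hx, AddMonoidAlgebra.one_def] at h1
  have hxf : x * f ≠ 0 := mul_ne_zero hx0 hf0
  have hsum : ∑ v ∈ (x * f).coeff.support, AddMonoidAlgebra.single v ((x * f).coeff v) = x * f :=
    AddMonoidAlgebra.sum_coeff_single _
  have hsupp : ∃ i ∈ (x * f).coeff.support, (x * f).coeff i ≠ 0 := by
    by_contra! h
    refine hxf ?_
    rw [← hsum]
    exact Finset.sum_eq_zero fun v hv => by rw [h v hv, AddMonoidAlgebra.single_zero]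
  obtain ⟨C, hC⟩ : ∃ C : ℤ, ∀ b : A, |ι b| ≤ C := by
    obtain ⟨C, hC⟩ := (Set.finite_range fun b => |ι b|).bddAbove
    exact ⟨C, fun b => hC ⟨b, rfl⟩⟩
  obtain ⟨L, hL0, hL⟩ := exists_diffs_eq_zero _ _ hsupp C
  refine ⟨L, hL0, fun c hc => hL _ (fun p => hC _) ?_⟩
  rw [hsum, laurentAction_mul]
  have hconst : ∀ q, laurentAction f (fun p => ι (c p)) q = κ := by
    intro q
    rw [hf, laurentAction_sum_single, ← hκ _ (hc ⟨-q, rfl⟩), ← Finset.sum_coe_sort]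
    simp [restrict, translate, add_comm]
  funext q
  rw [hx, map_sub, LinearMap.sub_apply, Pi.sub_apply, laurentAction_single, map_one,
    Module.End.one_apply, hconst, hconst]
  simp

/-! ### Functions vanishing on a half-plane -/

theorem diff_comm (v w : ℤ × ℤ) (g : ℤ × ℤ → ℤ) : diff v (diff w g) = diff w (diff v g) := by
  funext p
  simp only [diff, add_right_comm p v w]
  ring

theorem diffs_diff (L : List (ℤ × ℤ)) (w : ℤ × ℤ) (g : ℤ × ℤ → ℤ) :
    diffs L (diff w g) = diff w (diffs L g) := by
  induction L with
  | nil => rfl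
  | cons v L ih =>
    change diff v (diffs L (diff w g)) = diff w (diff v (diffs L g))
    rw [ih, diff_comm]

theorem diffs_sub (L : List (ℤ × ℤ)) (g h : ℤ × ℤ → ℤ) :
    diffs L (g - h) = diffs L g - diffs L h := by
  induction L with
  | nil => rfl
  | cons v L ih =>
    change diff v (diffs L (g - h)) = diff v (diffs L g) - diff v (diffs L h)
    rw [ih]
    funext p
    simp only [diff, Pi.sub_apply]
    ring

theorem apply_add_zsmul_of_diff_eq_zero {v : ℤ × ℤ} {g : ℤ × ℤ → ℤ} (h : diff v g = 0) (k : ℤ)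
    (p : ℤ × ℤ) : g (p + k • v) = g p := by
  have h1 : ∀ q, g (q + v) = g q := fun q => sub_eq_zero.1 (congrFun h q)
  induction k with
  | zero => simp
  | succ k ih => rw [add_smul, one_smul, ← add_assoc, h1, ih]
  | pred k ih => rw [← ih, ← h1 (p + (-(k : ℤ) - 1) • v), sub_smul, one_smul, add_assoc,
      sub_add_cancel]

theorem diff_zsmul_eq_zero {v : ℤ × ℤ} {g : ℤ × ℤ → ℤ} (h : diff v g = 0) (k : ℤ) :
    diff (k • v) g = 0 := by
  funext p
  exact sub_eq_zero.2 (apply_add_zsmul_of_diff_eq_zero h k p)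

/-- A `v`-periodic function that vanishes on a half-plane is zero if `v` is transversal. -/
theorem eq_zero_of_diff_eq_zero_of_halfPlane (ℓ : ℤ × ℤ →+ ℝ) {v : ℤ × ℤ} (hv : ℓ v ≠ 0)
    {g : ℤ × ℤ → ℤ} (h : diff v g = 0) {C : ℝ} (h0 : ∀ p, ℓ p < C → g p = 0) : g = 0 := by
  funext p
  obtain ⟨k, hk⟩ : ∃ k : ℤ, ℓ p + k * ℓ v < C := by
    rcases lt_or_gt_of_ne hv with h | h
    · obtain ⟨k, hk⟩ := exists_int_gt ((C - ℓ p) / ℓ v)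
      refine ⟨k, ?_⟩
      rw [div_lt_iff_of_neg h] at hk
      linarith
    · obtain ⟨k, hk⟩ := exists_int_lt ((C - ℓ p) / ℓ v)
      refine ⟨k, ?_⟩
      rw [lt_div_iff₀ h] at hk
      linarith
  rw [← apply_add_zsmul_of_diff_eq_zero h k p]
  refine h0 _ ?_
  rw [map_add, map_zsmul, zsmul_eq_mul]
  exact hk

theorem diff_vanish (ℓ : ℤ × ℤ →+ ℝ) (v : ℤ × ℤ) {g : ℤ × ℤ → ℤ}
    (h : ∃ C : ℝ, ∀ p, ℓ p < C → g p = 0) : ∃ C : ℝ, ∀ p, ℓ p < C → diff v g p = 0 := by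
  obtain ⟨C, hC⟩ := h
  refine ⟨min C (C - ℓ v), fun p hp => ?_⟩
  rw [lt_min_iff] at hp
  rw [diff, hC p hp.1, hC (p + v) (by rw [map_add]; linarith [hp.2]), sub_zero]

theorem diffs_vanish (ℓ : ℤ × ℤ →+ ℝ) (L : List (ℤ × ℤ)) {g : ℤ × ℤ → ℤ}
    (h : ∃ C : ℝ, ∀ p, ℓ p < C → g p = 0) : ∃ C : ℝ, ∀ p, ℓ p < C → diffs L g p = 0 := by
  induction L with
  | nil => exact h
  | cons v L ih => exact diff_vanish ℓ v ih

/-- A transversal difference can be cancelled, since the function it kills still vanishes on some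
half-plane. A difference along the boundary can be replaced by that of the common multiple $w$. -/
theorem iterate_diff_eq_zero (ℓ : ℤ × ℤ →+ ℝ) (L : List (ℤ × ℤ)) (w : ℤ × ℤ)
    (hw : ∀ v ∈ L, ℓ v = 0 → ∃ k : ℤ, w = k • v) (g : ℤ × ℤ → ℤ)
    (h0 : ∃ C : ℝ, ∀ p, ℓ p < C → g p = 0) (hg : diffs L g = 0) :
    (diff w)^[(L.filter fun v => ℓ v = 0).length] g = 0 := by
  classical
  induction L generalizing g with
  | nil => exact hg
  | cons v L ih =>
    have ih' := ih fun v' hv' => hw v' (List.mem_cons_of_mem v hv')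
    have hg' : diff v (diffs L g) = 0 := hg
    by_cases hv : ℓ v = 0
    · obtain ⟨k, hk⟩ := hw v List.mem_cons_self hv
      rw [List.filter_cons_of_pos (by simpa using hv), List.length_cons, Function.iterate_succ_apply]
      refine ih' _ (diff_vanish ℓ w h0) ?_
      rw [diffs_diff, hk]
      exact diff_zsmul_eq_zero hg' k
    · rw [List.filter_cons_of_neg (by simpa using hv)]
      refine ih' g h0 ?_
      obtain ⟨C, hC⟩ := diffs_vanish ℓ L h0
      exact eq_zero_of_diff_eq_zero_of_halfPlane ℓ hv hg' hC

/-- Along $w$ the function is an arithmetic progression, and a bounded one is constant. After $2C+1$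
steps a non-zero increment would exceed the possible variation $2C$. -/
theorem diff_eq_zero_of_diff_diff_eq_zero {w : ℤ × ℤ} {g : ℤ × ℤ → ℤ} {C : ℤ}
    (hC : ∀ p, |g p| ≤ C) (h : diff w (diff w g) = 0) : diff w g = 0 := by
  funext p
  have h1 : ∀ k : ℕ, g (p + (k : ℤ) • w) = g p + k * diff w g p := by
    intro k
    induction k with
    | zero => simp
    | succ k ih =>
      have h2 := apply_add_zsmul_of_diff_eq_zero h k p
      have h3 : diff w g (p + (k : ℤ) • w) = g (p + ((k + 1 : ℕ) : ℤ) • w) - g (p + (k : ℤ) • w) := by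
        rw [diff]; push_cast; rw [add_smul, one_smul, add_assoc]
      push_cast at h3 ⊢
      linarith
  by_contra hne
  have hne' : 1 ≤ |diff w g p| := Int.one_le_abs hne
  have hk := h1 (2 * C + 1).toNat
  have hC0 : 0 ≤ C := (abs_nonneg _).trans (hC p)
  rw [Int.toNat_of_nonneg (by omega)] at hk
  have h4 : |(2 * C + 1) * diff w g p| ≤ 2 * C := by
    have : (2 * C + 1) * diff w g p = g (p + (2 * C + 1) • w) - g p := by rw [hk]; ring
    rw [this]
    have := abs_sub (g (p + (2 * C + 1) • w)) (g p)
    linarith [hC p, hC (p + (2 * C + 1) • w)]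
  rw [abs_mul, abs_of_nonneg (by omega : (0 : ℤ) ≤ 2 * C + 1)] at h4
  nlinarith

theorem diff_eq_zero_of_iterate_diff_eq_zero {w : ℤ × ℤ} (k : ℕ) {g : ℤ × ℤ → ℤ} {C : ℤ}
    (hC : ∀ p, |g p| ≤ C) (h : (diff w)^[k] g = 0) : diff w g = 0 := by
  induction k generalizing g C with
  | zero =>
    have : g = 0 := h
    rw [this]; funext p; simp [diff]
  | succ k ih =>
    rw [Function.iterate_succ_apply] at h
    refine diff_eq_zero_of_diff_diff_eq_zero hC (ih (C := 2 * C) (fun p => ?_) h)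
    have := abs_sub (g (p + w)) (g p)
    have h1 := hC p
    have h2 := hC (p + w)
    rw [diff]; linarith

/-- A bounded function annihilated by differences and vanishing on a half-plane is periodic in the
direction of the boundary. -/
theorem diff_eq_zero_of_halfPlane (ℓ : ℤ × ℤ →+ ℝ) (L : List (ℤ × ℤ)) (w : ℤ × ℤ)
    (hw : ∀ v ∈ L, ℓ v = 0 → ∃ k : ℤ, w = k • v) {g : ℤ × ℤ → ℤ} {C : ℤ} (hC : ∀ p, |g p| ≤ C)
    (h0 : ∀ p, ℓ p < 0 → g p = 0) (hg : diffs L g = 0) : diff w g = 0 :=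
  diff_eq_zero_of_iterate_diff_eq_zero _ hC (iterate_diff_eq_zero ℓ L w hw g ⟨0, h0⟩ hg)

/-- A function annihilated by differences in transversal directions and vanishing on a half-plane
is zero. -/
theorem eq_zero_of_halfPlane (ℓ : ℤ × ℤ →+ ℝ) (L : List (ℤ × ℤ))
    (hL : ∀ v ∈ L, ℓ v ≠ 0) {g : ℤ × ℤ → ℤ}
    (h0 : ∀ p, ℓ p < 0 → g p = 0) (hg : diffs L g = 0) : g = 0 := by
  have h := iterate_diff_eq_zero ℓ L 0 (fun v hv h => absurd h (hL v hv)) g ⟨0, h0⟩ hg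
  rwa [List.filter_eq_nil_iff.2 (by simpa using hL)] at h

/-! ### Subshifts, minimality and compactness -/

open Filter

/-- A subshift: non-empty, translation invariant, and closed in the product topology. -/
structure IsSubshift {A : Type*} (Y : Set (Configuration A)) : Prop where
  nonempty : Y.Nonempty
  shift_mem : ∀ c ∈ Y, ∀ t : ℤ × ℤ, (fun p => c (p + t)) ∈ Y
  closed : ∀ c, (∀ F : Finset (ℤ × ℤ), ∃ y ∈ Y, ∀ p ∈ F, y p = c p) → c ∈ Y

theorem isSubshift_allowedSFT {A : Type*} {D : Finset (ℤ × ℤ)} {P : Set (Pattern A D)}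
    (h : (allowedSFT P).Nonempty) : IsSubshift (allowedSFT P) where
  nonempty := h
  shift_mem := by
    rintro c hc t _ ⟨s, rfl⟩
    refine hc ⟨s - t, ?_⟩
    funext d
    simp only [restrict, translate]
    congr 1; abel
  closed := by
    rintro c hc _ ⟨t, rfl⟩
    obtain ⟨y, hy, hyc⟩ := hc (D.image fun d => d - t)
    refine hy ⟨t, ?_⟩
    funext d
    exact hyc _ (Finset.mem_image_of_mem _ d.2)

theorem exists_ultrafilter_limit {A I : Type*} [Finite A] (𝒰 : Ultrafilter I)
    (y : I → Configuration A) : ∃ c : Configuration A, ∀ p, ∀ᶠ i in (𝒰 : Filter I), y i p = c p := by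
  have h : ∀ p, ∃ a, ∀ᶠ i in (𝒰 : Filter I), y i p = a := fun p =>
    Ultrafilter.eventually_exists_iff.1 (Eventually.of_forall fun i => ⟨y i p, rfl⟩)
  choose c hc using h
  exact ⟨c, hc⟩

theorem eventually_eq_on_finset {A I : Type*} {l : Filter I} {y : I → Configuration A}
    {c : Configuration A} (h : ∀ p, ∀ᶠ i in l, y i p = c p) (F : Finset (ℤ × ℤ)) :
    ∀ᶠ i in l, ∀ p ∈ F, y i p = c p :=
  (eventually_all_finset F).2 fun p _ => h p

theorem IsSubshift.limit_mem {A I : Type*} {Y : Set (Configuration A)} (hY : IsSubshift Y)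
    {l : Filter I} [l.NeBot] {y : I → Configuration A} {c : Configuration A}
    (hy : ∀ᶠ i in l, y i ∈ Y) (h : ∀ p, ∀ᶠ i in l, y i p = c p) : c ∈ Y := by
  refine hY.closed c fun F => ?_
  obtain ⟨i, hi, hi'⟩ := (hy.and (eventually_eq_on_finset h F)).exists
  exact ⟨y i, hi, hi'⟩

/-- Every subshift over a finite alphabet contains a minimal one. -/
theorem exists_minimal_subshift {A : Type*} [Finite A] {X : Set (Configuration A)}
    (hX : IsSubshift X) :
    ∃ Y ⊆ X, IsSubshift Y ∧ ∀ Z ⊆ Y, IsSubshift Z → Z = Y := by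
  obtain ⟨Y, hYX, hY⟩ := zorn_superset_nonempty {Z : Set (Configuration A) | IsSubshift Z} (by
    intro 𝒞 h𝒞 hchain hne
    have : Nonempty 𝒞 := hne.to_subtype
    -- Tails of the chain towards smaller members: a limit along this filter of points chosen in the
    -- members lies in every member.
    set l : Filter 𝒞 := ⨅ S : 𝒞, 𝓟 {T : 𝒞 | T.1 ⊆ S.1} with hl
    have hdir : Directed (· ≥ ·) fun S : 𝒞 => 𝓟 {T : 𝒞 | T.1 ⊆ S.1} := by
      intro S T
      rcases hchain.total S.2 T.2 with h | h
      · exact ⟨S, le_rfl, principal_mono.2 fun R hR => Set.Subset.trans hR h⟩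
      · exact ⟨T, principal_mono.2 fun R hR => Set.Subset.trans hR h, le_rfl⟩
    have : l.NeBot := iInf_neBot_of_directed hdir fun S => principal_neBot_iff.2 ⟨S, Set.Subset.refl S.1⟩
    choose y hy using fun S : 𝒞 => (h𝒞 S.2).nonempty
    obtain ⟨c, hc⟩ := exists_ultrafilter_limit (Ultrafilter.of l) y
    refine ⟨⋂₀ 𝒞, ⟨⟨c, fun S hS => ?_⟩, fun c hc t S hS => ?_, fun c hc S hS => ?_⟩,
      fun S hS => Set.sInter_subset_of_mem hS⟩
    · refine (h𝒞 hS).limit_mem (l := (Ultrafilter.of l : Filter 𝒞)) ?_ hc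
      refine Ultrafilter.of_le l ?_
      have hmem : {T : 𝒞 | T.1 ⊆ S} ∈ l := mem_iInf_of_mem ⟨S, hS⟩ (mem_principal_self _)
      filter_upwards [hmem] with T hT
      exact hT (hy T)
    · exact (h𝒞 hS).shift_mem c (hc S hS) t
    · refine (h𝒞 hS).closed c fun F => ?_
      obtain ⟨y, hy, hyc⟩ := hc F
      exact ⟨y, hy S hS, hyc⟩) X hX
  exact ⟨Y, hYX, hY.prop, fun Z hZ hZs => subset_antisymm hZ (hY.le_of_le hZs hZ)⟩

theorem exists_ne_agree_on_finset {A : Type*} [Finite A] {Y : Set (Configuration A)}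
    (hY : Y.Infinite) (F : Finset (ℤ × ℤ)) :
    ∃ y ∈ Y, ∃ y' ∈ Y, y ≠ y' ∧ ∀ p ∈ F, y p = y' p := by
  obtain ⟨y, hy, y', hy', hne, h⟩ := hY.exists_ne_map_eq_of_mapsTo
    (f := fun y : Configuration A => fun p : F => y p) (t := Set.univ) (fun _ _ => Set.mem_univ _)
    Set.finite_univ
  exact ⟨y, hy, y', hy', hne, fun p hp => congrFun h ⟨p, hp⟩⟩

/-- The functional `p ↦ ⟨p, u⟩` on `ℤ²`. -/
noncomputable def dotHom (u : ℝ × ℝ) : ℤ × ℤ →+ ℝ where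
  toFun p := p.1 * u.1 + p.2 * u.2
  map_zero' := by simp
  map_add' p q := by push_cast [Prod.fst_add, Prod.snd_add]; ring

/-- A point $p$ of disagreement nearest to the origin in Euclidean distance is moved to $0$. The
configurations then agree on the open disc $|q+p|<|p|$, that is $|q|^2+2\langle q,p\rangle<0$, which
tends to a half-plane as $|p|$ grows. The unit vector $u$ is normalised in the sup norm of `ℝ × ℝ`.
-/
theorem exists_first_difference {A : Type*} [Finite A] {Y : Set (Configuration A)}
    (hY : IsSubshift Y) (hinf : Y.Infinite) (n : ℕ) :
    ∃ z ∈ Y, ∃ z' ∈ Y, z 0 ≠ z' 0 ∧ ∃ (s : ℝ) (u : ℝ × ℝ), (n : ℝ) < s ∧ ‖u‖ = 1 ∧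
      ∀ q : ℤ × ℤ, (q.1 : ℝ) ^ 2 + (q.2 : ℝ) ^ 2 + 2 * s * dotHom u q < 0 → z q = z' q := by
  obtain ⟨y, hy, y', hy', hne, hF⟩ := exists_ne_agree_on_finset hinf
    (Finset.Icc (-(n : ℤ)) n ×ˢ Finset.Icc (-(n : ℤ)) n)
  obtain ⟨p, hp, hmin⟩ := WellFounded.has_min
    (measure fun p : ℤ × ℤ => (p.1 ^ 2 + p.2 ^ 2).toNat).wf {p | y p ≠ y' p}
    (Function.ne_iff.1 hne)
  set x : ℝ × ℝ := ((p.1 : ℝ), (p.2 : ℝ)) with hx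
  have hs : (n : ℝ) < ‖x‖ := by
    by_contra! hle
    refine hp (hF p ?_)
    rw [Prod.norm_def, max_le_iff, Real.norm_eq_abs, Real.norm_eq_abs, abs_le, abs_le] at hle
    simp only [hx] at hle
    simp only [Finset.mem_product, Finset.mem_Icc]
    exact_mod_cast hle
  have hs0 : 0 < ‖x‖ := lt_of_le_of_lt (Nat.cast_nonneg n) hs
  refine ⟨_, hY.shift_mem y hy p, _, hY.shift_mem y' hy' p, by simpa using hp, ‖x‖, ‖x‖⁻¹ • x, hs,
    ?_, ?_⟩
  · rw [norm_smul, norm_inv, norm_norm, inv_mul_cancel₀ hs0.ne']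
  · intro q hq
    by_contra hqne
    refine hmin (q + p) hqne ?_
    have h1 : ‖x‖ * dotHom (‖x‖⁻¹ • x) q = q.1 * p.1 + q.2 * p.2 := by
      simp only [dotHom, AddMonoidHom.coe_mk, ZeroHom.coe_mk, Prod.smul_fst, Prod.smul_snd,
        smul_eq_mul]
      field_simp
      simp only [hx]
    have h2 : q.1 ^ 2 + q.2 ^ 2 + 2 * (q.1 * p.1 + q.2 * p.2) < 0 := by
      rw [mul_assoc, h1] at hq
      exact_mod_cast hq
    change ((q + p).1 ^ 2 + (q + p).2 ^ 2).toNat < (p.1 ^ 2 + p.2 ^ 2).toNat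
    have h3 : ∀ a b : ℤ, 0 ≤ a → a < b → a.toNat < b.toNat := fun a b _ _ => by omega
    refine h3 _ _ (by positivity) ?_
    simp only [Prod.fst_add, Prod.snd_add]
    linarith

/-- An infinite subshift has two different configurations that agree on an open half-plane. -/
theorem exists_ne_agree_on_halfPlane {A : Type*} [Finite A] {Y : Set (Configuration A)}
    (hY : IsSubshift Y) (hinf : Y.Infinite) :
    ∃ u : ℝ × ℝ, u ≠ 0 ∧ ∃ z ∈ Y, ∃ z' ∈ Y, z 0 ≠ z' 0 ∧ ∀ q, dotHom u q < 0 → z q = z' q := by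
  choose z hz z' hz' hne s u hs hu h using exists_first_difference hY hinf
  set 𝒰 : Ultrafilter ℕ := hyperfilter ℕ
  have h𝒰 : (𝒰 : Filter ℕ) ≤ atTop := by
    rw [← Nat.cofinite_eq_atTop]; exact hyperfilter_le_cofinite
  obtain ⟨c, hc⟩ := exists_ultrafilter_limit 𝒰 z
  obtain ⟨c', hc'⟩ := exists_ultrafilter_limit 𝒰 z'
  obtain ⟨u₀, hu₀, hlim⟩ := (isCompact_sphere (0 : ℝ × ℝ) 1).ultrafilter_le_nhds (𝒰.map u) (by
    rw [le_principal_iff]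
    exact mem_map.2 (Eventually.of_forall fun n : ℕ => by simpa using hu n))
  have hlim' : Tendsto u 𝒰 (nhds u₀) := hlim
  refine ⟨u₀, ?_, c, hY.limit_mem (Eventually.of_forall hz) hc, c',
    hY.limit_mem (Eventually.of_forall hz') hc', ?_, ?_⟩
  · rintro rfl
    simp at hu₀
  · obtain ⟨n, h1, h2⟩ := ((hc 0).and (hc' 0)).exists
    rw [← h1, ← h2]; exact hne n
  · intro q hq
    have hcont : Continuous fun v : ℝ × ℝ => dotHom v q := by
      simp only [dotHom, AddMonoidHom.coe_mk, ZeroHom.coe_mk]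
      fun_prop
    have h1 : ∀ᶠ n in (𝒰 : Filter ℕ), dotHom (u n) q < dotHom u₀ q / 2 :=
      ((hcont.tendsto u₀).comp hlim').eventually_lt_const (by linarith)
    -- Beyond $N$ the linear term of the disc inequality outweighs $|q|^2$.
    obtain ⟨N, hN⟩ := exists_nat_gt (((q.1 : ℝ) ^ 2 + (q.2 : ℝ) ^ 2) / (-dotHom u₀ q))
    rw [div_lt_iff₀ (by linarith)] at hN
    have h2 : ∀ᶠ n in (𝒰 : Filter ℕ), N ≤ n := h𝒰 (eventually_ge_atTop N)
    obtain ⟨n, h1, h2, h3, h4⟩ := (h1.and (h2.and ((hc q).and (hc' q)))).exists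
    rw [← h3, ← h4]
    refine h n q ?_
    have h5 : (N : ℝ) ≤ n := by exact_mod_cast h2
    have h6 := hs n
    have h7 : (0 : ℝ) ≤ N := Nat.cast_nonneg N
    nlinarith

/-- A finite subshift contains only periodic configurations. -/
theorem IsSubshift.exists_period_of_finite {A : Type*} {Y : Set (Configuration A)}
    (hY : IsSubshift Y) (hfin : Y.Finite) {c : Configuration A} (hc : c ∈ Y) :
    ∃ t : ℤ × ℤ, t ≠ 0 ∧ ∀ p, c (p + t) = c p := by
  obtain ⟨i, -, j, -, hij, h⟩ := (Set.infinite_univ (α := ℤ)).exists_ne_map_eq_of_mapsTo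
    (f := fun (i : ℤ) (p : ℤ × ℤ) => c (p + (i, 0))) (t := Y)
    (fun i _ => hY.shift_mem c hc _) hfin
  refine ⟨(i - j, 0), by simpa [sub_eq_zero] using hij, fun p => ?_⟩
  have h1 := congrFun h (p - (j, 0))
  simp only [sub_add_cancel] at h1
  rw [← h1]
  congr 1
  ext <;> simp; ring

/-! ### From one-sided non-determinism to the opposite side -/

/-- The difference of the two configurations, read through `ι`, is `(W, 0)`-periodic. -/
def PeriodicDifference {A : Type*} (ι : A → ℤ) (W : ℕ) (d d' : Configuration A) : Prop :=
  ∀ p : ℤ × ℤ, ι (d (p + ((W : ℤ), 0))) - ι (d' (p + ((W : ℤ), 0))) = ι (d p) - ι (d' p)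

section OneSided

variable {A : Type*} {ι : A → ℤ} {W : ℕ}

theorem PeriodicDifference.refl (d : Configuration A) : PeriodicDifference ι W d d := by
  intro p; simp

theorem PeriodicDifference.symm {d d' : Configuration A} (h : PeriodicDifference ι W d d') :
    PeriodicDifference ι W d' d := by
  intro p; linarith [h p]

theorem PeriodicDifference.trans {d d' d'' : Configuration A} (h : PeriodicDifference ι W d d')
    (h' : PeriodicDifference ι W d' d'') : PeriodicDifference ι W d d'' := by
  intro p; linarith [h p, h' p]

theorem PeriodicDifference.shift {d d' : Configuration A} (h : PeriodicDifference ι W d d')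
    (t : ℤ × ℤ) : PeriodicDifference ι W (fun p => d (p + t)) (fun p => d' (p + t)) := by
  intro p
  have := h (p + t)
  rwa [add_right_comm p t] at this

theorem PeriodicDifference.limit {I : Type*} {l : Filter I} [l.NeBot]
    {y y' : I → Configuration A} {c c' : Configuration A}
    (h : ∀ i, PeriodicDifference ι W (y i) (y' i)) (hc : ∀ p, ∀ᶠ i in l, y i p = c p)
    (hc' : ∀ p, ∀ᶠ i in l, y' i p = c' p) : PeriodicDifference ι W c c' := by
  intro p
  obtain ⟨i, h1, h2, h3, h4⟩ := ((hc p).and ((hc' p).and ((hc (p + ((W : ℤ), 0))).and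
    (hc' (p + ((W : ℤ), 0)))))).exists
  rw [← h1, ← h2, ← h3, ← h4]
  exact h i p

theorem PeriodicDifference.agree_iff (hι : Function.Injective ι) {d d' : Configuration A}
    (h : PeriodicDifference ι W d d') (k : ℤ) (p : ℤ × ℤ) :
    d (p + (k * W, 0)) = d' (p + (k * W, 0)) ↔ d p = d' p := by
  have hdiff : diff ((W : ℤ), 0) (fun p => ι (d p) - ι (d' p)) = 0 := by
    funext q; exact sub_eq_zero.2 (h q)
  have h1 := apply_add_zsmul_of_diff_eq_zero hdiff k p
  have h2 : k • ((W : ℤ), (0 : ℤ)) = (k * W, 0) := by simp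
  rw [h2] at h1
  rw [← hι.eq_iff, ← hι.eq_iff (a := d p), ← sub_eq_zero, h1, sub_eq_zero]

/-- A fundamental domain of the strip of the `M` rows up to row `r`. -/
noncomputable def stripBox (W M : ℕ) (r : ℤ) : Finset (ℤ × ℤ) :=
  Finset.Ico 0 (W : ℤ) ×ˢ Finset.Ioc (r - M) r

theorem PeriodicDifference.agree_strip (hι : Function.Injective ι) (hW : 0 < W)
    {d d' : Configuration A} (h : PeriodicDifference ι W d d') {M : ℕ} {r : ℤ}
    (hbox : ∀ p ∈ stripBox W M r, d p = d' p) (p : ℤ × ℤ) (h1 : r - M < p.2) (h2 : p.2 ≤ r) :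
    d p = d' p := by
  have hW' : (0 : ℤ) < W := by exact_mod_cast hW
  have h3 := hbox (p.1 % W, p.2) (by
    simp only [stripBox, Finset.mem_product, Finset.mem_Ico, Finset.mem_Ioc]
    exact ⟨⟨Int.emod_nonneg _ hW'.ne', Int.emod_lt_of_pos _ hW'⟩, h1, h2⟩)
  rw [← h.agree_iff hι (p.1 / W)] at h3
  have h4 : ((p.1 % W, p.2) : ℤ × ℤ) + (p.1 / W * W, 0) = p := by
    ext
    · simp [Int.emod_add_ediv_mul]
    · simp
  rwa [h4] at h3

/-- Compactness: pairs agreeing on ever more rows above the origin but not at it would have a limit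
contradicting `hno`, because periodicity of the difference survives limits. The bounded height then
propagates agreement downward cell by cell. -/
theorem exists_determining_height [Finite A] {Y : Set (Configuration A)} (hY : IsSubshift Y)
    (hno : ∀ e ∈ Y, ∀ e' ∈ Y, PeriodicDifference ι W e e' → (∀ p : ℤ × ℤ, 0 < p.2 → e p = e' p) →
      e 0 = e' 0) :
    ∃ M : ℕ, ∀ e ∈ Y, ∀ e' ∈ Y, PeriodicDifference ι W e e' → ∀ r : ℤ,
      (∀ p : ℤ × ℤ, r - M < p.2 → p.2 ≤ r → e p = e' p) → ∀ p : ℤ × ℤ, p.2 ≤ r → e p = e' p := by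
  obtain ⟨M, hM⟩ : ∃ M : ℕ, ∀ e ∈ Y, ∀ e' ∈ Y, PeriodicDifference ι W e e' →
      (∀ p : ℤ × ℤ, 0 < p.2 → p.2 ≤ M → e p = e' p) → e 0 = e' 0 := by
    by_contra! hcon
    choose e he e' he' hper hag hne using hcon
    obtain ⟨c, hc⟩ := exists_ultrafilter_limit (hyperfilter ℕ) e
    obtain ⟨c', hc'⟩ := exists_ultrafilter_limit (hyperfilter ℕ) e'
    have hle : (hyperfilter ℕ : Filter ℕ) ≤ atTop := by
      rw [← Nat.cofinite_eq_atTop]; exact hyperfilter_le_cofinite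
    have h0 := hno c (hY.limit_mem (Eventually.of_forall he) hc) c'
      (hY.limit_mem (Eventually.of_forall he') hc') (PeriodicDifference.limit hper hc hc') (by
        intro p hp
        obtain ⟨n, h1, h2, h3⟩ := ((hc p).and ((hc' p).and
          (hle (eventually_ge_atTop p.2.toNat)))).exists
        rw [← h1, ← h2]
        exact hag n p hp (by omega))
    obtain ⟨n, h1, h2⟩ := ((hc 0).and (hc' 0)).exists
    exact hne n (by rw [h1, h2, h0])
  refine ⟨M, fun e he e' he' hper r hag => ?_⟩
  have hk : ∀ k : ℕ, ∀ p : ℤ × ℤ, r - M - k < p.2 → p.2 ≤ r → e p = e' p := by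
    intro k
    induction k with
    | zero => intro p h1 h2; exact hag p (by simpa using h1) h2
    | succ k ih =>
      intro p h1 h2
      by_cases h3 : r - M - k < p.2
      · exact ih p h3 h2
      · have := hM _ (hY.shift_mem e he p) _ (hY.shift_mem e' he' p) (hper.shift p) (by
          intro q hq hq'
          push_cast at h1
          exact ih _ (by simp only [Prod.snd_add]; omega) (by simp only [Prod.snd_add]; omega))
        simpa using this
  intro p hp
  exact hk (r - M - p.2 + 1).toNat p (by omega) hp

/-- Agreement on a strip forces agreement on everything below it, so a strip above a chosen
disagreement of each pair still separates all pairs. Periodic differences reduce the strip to a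
finite box. -/
theorem exists_separating_height (hι : Function.Injective ι) (hW : 0 < W)
    {Y : Set (Configuration A)} {M : ℕ}
    (hM : ∀ e ∈ Y, ∀ e' ∈ Y, PeriodicDifference ι W e e' → ∀ r : ℤ,
      (∀ p : ℤ × ℤ, r - M < p.2 → p.2 ≤ r → e p = e' p) → ∀ p : ℤ × ℤ, p.2 ≤ r → e p = e' p)
    {n : ℕ} {e : Fin n → Configuration A} (he : ∀ i, e i ∈ Y)
    (hper : ∀ i j, PeriodicDifference ι W (e i) (e j)) (hinj : Function.Injective e) :
    ∃ R : ℤ, ∀ r ≥ R, ∀ i j, i ≠ j → ∃ p ∈ stripBox W M r, e i p ≠ e j p := by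
  have h1 : ∀ i j, ∃ p, i ≠ j → e i p ≠ e j p := by
    intro i j
    by_cases hij : i = j
    · exact ⟨0, fun h => absurd hij h⟩
    · obtain ⟨p, hp⟩ := Function.ne_iff.1 (hinj.ne hij)
      exact ⟨p, fun _ => hp⟩
  choose p hp using h1
  obtain ⟨R, hR⟩ := (Set.finite_range fun ij : Fin n × Fin n => (p ij.1 ij.2).2).bddAbove
  refine ⟨R, fun r hr i j hij => ?_⟩
  by_contra! hcon
  refine hp i j hij (hM _ (he i) _ (he j) (hper i j) r ?_ _ ((hR ⟨(i, j), rfl⟩).trans hr))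
  exact (hper i j).agree_strip hι hW hcon

/-- High enough, the members of a tuple have distinct patterns on one finite box, whose number of
patterns bounds the size of the tuple. -/
theorem exists_maximal_tuple [Finite A] (hι : Function.Injective ι) (hW : 0 < W)
    {Y : Set (Configuration A)} (hY : IsSubshift Y) {M : ℕ}
    (hM : ∀ e ∈ Y, ∀ e' ∈ Y, PeriodicDifference ι W e e' → ∀ r : ℤ,
      (∀ p : ℤ × ℤ, r - M < p.2 → p.2 ≤ r → e p = e' p) → ∀ p : ℤ × ℤ, p.2 ≤ r → e p = e' p) :
    ∃ n, 0 < n ∧ (∃ e : Fin n → Configuration A, (∀ i, e i ∈ Y) ∧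
      (∀ i j, PeriodicDifference ι W (e i) (e j)) ∧ Function.Injective e) ∧
      ¬ ∃ e : Fin (n + 1) → Configuration A, (∀ i, e i ∈ Y) ∧
      (∀ i j, PeriodicDifference ι W (e i) (e j)) ∧ Function.Injective e := by
  set S : ℕ → Prop := fun n => ∃ e : Fin n → Configuration A, (∀ i, e i ∈ Y) ∧
      (∀ i j, PeriodicDifference ι W (e i) (e j)) ∧ Function.Injective e with hS
  have hbound : ∀ n, S n → n ≤ Nat.card (stripBox W M 0 → A) := by
    rintro n ⟨e, he, hper, hinj⟩
    obtain ⟨R, hR⟩ := exists_separating_height hι hW hM he hper hinj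
    have hinj' : Function.Injective fun (i : Fin n) (p : stripBox W M 0) => e i (p.1 + (0, R)) := by
      intro i j hij
      by_contra hne
      obtain ⟨p, hp, hpne⟩ := hR R le_rfl i j hne
      refine hpne ?_
      have h1 := congrFun hij ⟨p - (0, R), by
        simp only [stripBox, Finset.mem_product, Finset.mem_Ico, Finset.mem_Ioc, Prod.fst_sub,
          Prod.snd_sub] at hp ⊢
        omega⟩
      simpa using h1
    simpa using Nat.card_le_card_of_injective _ hinj'
  obtain ⟨y, hy⟩ := hY.nonempty
  have hS1 : S 1 := ⟨fun _ => y, fun _ => hy, fun _ _ => PeriodicDifference.refl y,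
    Function.injective_of_subsingleton _⟩
  by_contra! hcon
  have hall : ∀ n, S (n + 1) := by
    intro n
    induction n with
    | zero => exact hS1
    | succ n ih => exact hcon (n + 1) (Nat.succ_pos n) ih
  have := hbound _ (hall (Nat.card (stripBox W M 0 → A)))
  omega

/-- A tuple of configurations with periodic differences, any two of which differ on every strip of
`M` rows. -/
structure IsSpread (Y : Set (Configuration A)) (ι : A → ℤ) (W M : ℕ) {n : ℕ}
    (e : Fin n → Configuration A) : Prop where
  mem : ∀ i, e i ∈ Y
  periodic : ∀ i j, PeriodicDifference ι W (e i) (e j)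
  spread : ∀ r : ℤ, ∀ i j, i ≠ j → ∃ p ∈ stripBox W M r, e i p ≠ e j p

theorem isSpread_limit {Y : Set (Configuration A)} (hY : IsSubshift Y) {M n : ℕ} {I : Type*}
    {l : Filter I} [l.NeBot] {e : I → Fin n → Configuration A} (he : ∀ k i, e k i ∈ Y)
    (hper : ∀ k i j, PeriodicDifference ι W (e k i) (e k j))
    (hspread : ∀ r : ℤ, ∀ᶠ k in l, ∀ i j, i ≠ j → ∃ p ∈ stripBox W M r, e k i p ≠ e k j p)
    {c : Fin n → Configuration A} (hc : ∀ i p, ∀ᶠ k in l, e k i p = c i p) :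
    IsSpread Y ι W M c where
  mem i := hY.limit_mem (Eventually.of_forall fun k => he k i) (hc i)
  periodic i j := PeriodicDifference.limit (fun k => hper k i j) (hc i) (hc j)
  spread r i j hij := by
    obtain ⟨k, h1, h2, h3⟩ := ((hspread r).and ((eventually_eq_on_finset (hc i)
      (stripBox W M r)).and (eventually_eq_on_finset (hc j) (stripBox W M r)))).exists
    obtain ⟨p, hp, hne⟩ := h1 i j hij
    exact ⟨p, hp, by rwa [← h2 p hp, ← h3 p hp]⟩

theorem isSubshift_spread [Finite A] (hι : Function.Injective ι) (hW : 0 < W)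
    {Y : Set (Configuration A)} (hY : IsSubshift Y) {M n : ℕ}
    (hne : ∃ y, ∃ e : Fin n → Configuration A, IsSpread Y ι W M e ∧ ∃ i, e i = y) :
    IsSubshift {y | ∃ e : Fin n → Configuration A, IsSpread Y ι W M e ∧ ∃ i, e i = y} where
  nonempty := hne
  shift_mem := by
    rintro _ ⟨e, he, i, rfl⟩ t
    refine ⟨fun j p => e j (p + t), ⟨fun j => hY.shift_mem _ (he.mem j) t,
      fun j k => (he.periodic j k).shift t, fun r j k hjk => ?_⟩, i, rfl⟩
    by_contra! hcon
    obtain ⟨p, hp, hpne⟩ := he.spread (r + t.2) j k hjk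
    simp only [stripBox, Finset.mem_product, Finset.mem_Ico, Finset.mem_Ioc] at hp
    have h1 := ((he.periodic j k).shift t).agree_strip hι hW hcon (p - t)
      (by simp only [Prod.snd_sub]; omega) (by simp only [Prod.snd_sub]; omega)
    simp only [sub_add_cancel] at h1
    exact hpne h1
  closed := by
    intro c hc
    choose y hy hyc using hc
    choose e he i hi using hy
    set 𝒰 : Ultrafilter (Finset (ℤ × ℤ)) := Ultrafilter.of atTop
    have h𝒰 : (𝒰 : Filter (Finset (ℤ × ℤ))) ≤ atTop := Ultrafilter.of_le _
    choose f hf using fun j => exists_ultrafilter_limit 𝒰 fun F => e F j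
    obtain ⟨i₀, hi₀⟩ := Ultrafilter.eventually_exists_iff.1
      (Eventually.of_forall fun F => ⟨i F, rfl⟩ : ∀ᶠ F in (𝒰 : Filter _), ∃ j, i F = j)
    refine ⟨f, isSpread_limit hY (fun F => (he F).mem) (fun F => (he F).periodic)
      (fun r => Eventually.of_forall fun F => (he F).spread r) hf, i₀, ?_⟩
    funext p
    obtain ⟨F, h1, h2, h3⟩ := ((hf i₀ p).and (hi₀.and
      (h𝒰 (eventually_ge_atTop {p})))).exists
    rw [← h1, ← h2, hi]
    exact hyc F p (Finset.singleton_subset_iff.1 h3)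

/-- In a minimal subshift, the upward non-determinism through periodic differences implies the
downward one. -/
theorem exists_pair_agree_above [Finite A] (hι : Function.Injective ι) (hW : 0 < W)
    {Y : Set (Configuration A)} (hY : IsSubshift Y) (hmin : ∀ Z ⊆ Y, IsSubshift Z → Z = Y)
    {d d' : Configuration A} (hd : d ∈ Y) (hd' : d' ∈ Y) (hper : PeriodicDifference ι W d d')
    (hne : d ≠ d') (hag : ∀ p : ℤ × ℤ, p.2 < 0 → d p = d' p) :
    ∃ e ∈ Y, ∃ e' ∈ Y, (∀ p : ℤ × ℤ, 0 < p.2 → e p = e' p) ∧ e 0 ≠ e' 0 := by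
  by_contra! hcon
  obtain ⟨M, hM⟩ := exists_determining_height (ι := ι) (W := W) hY
    fun e he e' he' _ h => hcon e he e' he' h
  obtain ⟨n, hn, ⟨e, he, heper, hinj⟩, hmax⟩ := exists_maximal_tuple hι hW hY hM
  obtain ⟨R, hR⟩ := exists_separating_height hι hW hM he heper hinj
  have hle : (hyperfilter ℕ : Filter ℕ) ≤ atTop := by
    rw [← Nat.cofinite_eq_atTop]; exact hyperfilter_le_cofinite
  -- A maximal tuple is separated on all high strips; the limit of its translates, moved down, is
  -- separated on every strip.
  choose f hf using fun j => exists_ultrafilter_limit (hyperfilter ℕ)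
    fun (k : ℕ) (p : ℤ × ℤ) => e j (p + (0, (k : ℤ)))
  have hf' : IsSpread Y ι W M f := by
    refine isSpread_limit hY (e := fun (k : ℕ) j p => e j (p + (0, (k : ℤ))))
      (fun k i => hY.shift_mem _ (he i) _) (fun k i j => (heper i j).shift _) (fun r => ?_) hf
    filter_upwards [hle (eventually_ge_atTop (R - r).toNat)] with k hk i j hij
    by_contra! hbox
    obtain ⟨p, hp, hpne⟩ := hR (r + k) (by omega) i j hij
    refine hpne ?_
    simp only [stripBox, Finset.mem_product, Finset.mem_Ico, Finset.mem_Ioc] at hp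
    have h1 := hbox (p - (0, (k : ℤ))) (by
      simp only [stripBox, Finset.mem_product, Finset.mem_Ico, Finset.mem_Ioc, Prod.fst_sub,
        Prod.snd_sub]
      omega)
    simpa using h1
  -- By minimality every element of `Y`, in particular `d`, lies in a spread tuple of the maximal
  -- size `n`. Adding `d'` will give a larger tuple.
  have hT := hmin _ (by rintro _ ⟨e, he, i, rfl⟩; exact he.mem i)
    (isSubshift_spread hι hW hY ⟨f ⟨0, hn⟩, f, hf', ⟨0, hn⟩, rfl⟩)
  rw [← hT] at hd
  obtain ⟨g, hg, i, rfl⟩ := hd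
  have hgd' : ∀ j, PeriodicDifference ι W d' (g j) := fun j =>
    hper.symm.trans (hg.periodic i j)
  refine hmax ⟨Fin.cons d' g, Fin.cases hd' hg.mem, ?_, ?_⟩
  · refine Fin.cases (Fin.cases (PeriodicDifference.refl _) hgd') fun j =>
      Fin.cases (hgd' j).symm (hg.periodic j)
  · rw [Fin.cons_injective_iff]
    constructor
    · rintro ⟨j, hj⟩
      have hij : i ≠ j := by rintro rfl; exact hne hj
      -- Below row $0$, `d'` coincides with `d`, which differs there from every other member of its
      -- tuple.
      obtain ⟨p, hp, hpne⟩ := hg.spread (-1) i j hij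
      simp only [stripBox, Finset.mem_product, Finset.mem_Ico, Finset.mem_Ioc] at hp
      exact hpne (by rw [hj]; exact hag p (by omega))
    · intro j k hjk
      by_contra hjk'
      obtain ⟨p, -, hpne⟩ := hg.spread 0 j k hjk'
      exact hpne (congrFun hjk p)

end OneSided

/-! ### The Morse–Hedlund theorem -/

/-- The word of length `k` of the sequence `w` at position `i`. -/
def window {α : Type*} (w : ℤ → α) (k : ℕ) (i : ℤ) : Fin k → α := fun j => w (i + j)

/-- The Morse–Hedlund theorem with an explicit bound on the period. -/
theorem exists_period_of_ncard_window_le {α : Type*} [Finite α] (w : ℤ → α) {n : ℕ}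
    (h : (Set.range (window w n)).ncard ≤ n) :
    ∃ q : ℕ, 0 < q ∧ q ≤ n ∧ Function.Periodic w q := by
  have hinit : ∀ k i, (fun j : Fin k => window w (k + 1) i j.castSucc) = window w k i := by
    intro k i; funext j; simp [window]
  have htail : ∀ k i, (fun j : Fin k => window w (k + 1) i j.succ) = window w k (i + 1) := by
    intro k i; funext j; simp only [window, Fin.val_succ]; push_cast; congr 1; ring
  have himage : ∀ k, (fun v (j : Fin k) => v j.castSucc) '' Set.range (window w (k + 1))
      = Set.range (window w k) := by
    intro k
    rw [← Set.range_comp]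
    exact congrArg Set.range (funext fun i => hinit k i)
  have himage' : ∀ k, (fun v (j : Fin k) => v j.succ) '' Set.range (window w (k + 1))
      = Set.range (window w k) := by
    intro k
    rw [← Set.range_comp]
    have h1 : (fun v (j : Fin k) => v j.succ) ∘ window w (k + 1)
        = window w k ∘ fun i => i + 1 := funext fun i => htail k i
    rw [h1]
    exact (Equiv.addRight (1 : ℤ)).surjective.range_comp (window w k)
  have hmono : Monotone fun k => (Set.range (window w k)).ncard := by
    refine monotone_nat_of_le_succ fun k => ?_
    rw [← himage k]
    exact Set.ncard_image_le (Set.toFinite _)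
  -- There is one word of length $0$, so $n$ strict increases would produce more than $n$ words of
  -- length $n$.
  obtain ⟨k, hk, hle⟩ : ∃ k < n, (Set.range (window w (k + 1))).ncard
      ≤ (Set.range (window w k)).ncard := by
    by_contra! hcon
    have h1 : ∀ k ≤ n, k + 1 ≤ (Set.range (window w k)).ncard := by
      intro k
      induction k with
      | zero => intro _; rw [Nat.succ_le_iff, Set.ncard_pos]; exact Set.range_nonempty _
      | succ k ih => intro hk; have := ih (by omega); have := hcon k (by omega); omega
    have := h1 n le_rfl
    omega
  have hk_eq := le_antisymm hle (hmono (Nat.le_succ k))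
  -- Equal counts make deletion of the last letter, and likewise of the first, injective: a word of
  -- length $k$ determines both its neighbours.
  have hinj := Set.injOn_of_ncard_image_eq ((congrArg Set.ncard (himage k)).trans hk_eq.symm)
    (Set.toFinite _)
  have hinj' := Set.injOn_of_ncard_image_eq ((congrArg Set.ncard (himage' k)).trans hk_eq.symm)
    (Set.toFinite _)
  have hext : ∀ i i', window w k i = window w k i' → window w (k + 1) i = window w (k + 1) i' :=
    fun i i' hii => hinj ⟨i, rfl⟩ ⟨i', rfl⟩ ((hinit k i).trans (hii.trans (hinit k i').symm))
  have hsucc : ∀ i i', window w k i = window w k i' → window w k (i + 1) = window w k (i' + 1) :=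
    fun i i' hii => by rw [← htail, ← htail, hext i i' hii]
  have hpred : ∀ i i', window w k (i + 1) = window w k (i' + 1) → window w k i = window w k i' :=
    fun i i' hii => by
      have h1 := hinj' ⟨i, rfl⟩ ⟨i', rfl⟩ ((htail k i).trans (hii.trans (htail k i').symm))
      rw [← hinit k i, ← hinit k i', h1]
  -- Among the $n+1$ positions $0,\dots,n$ two carry the same word; this bounds the period by $n$.
  obtain ⟨i, hi, i', hi', hne, heq⟩ := Set.exists_ne_map_eq_of_ncard_lt_of_maps_to
    (s := Set.Icc 0 n) (t := Set.range (window w k)) (f := fun i : ℕ => window w k i)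
    (by
      rw [← Finset.coe_Icc, Set.ncard_coe_finset, Nat.card_Icc]
      have := hmono hk.le
      simp only at this
      omega)
    (fun i _ => ⟨i, rfl⟩)
  wlog hlt : i < i' generalizing i i'
  · exact this i' hi' i hi hne.symm heq.symm (lt_of_le_of_ne (not_lt.1 hlt) hne.symm)
  refine ⟨i' - i, by omega, by have := hi'.2; omega, fun x => ?_⟩
  have hall : ∀ m : ℤ, window w k (i + m) = window w k (i' + m) := by
    intro m
    induction m with
    | zero => simpa using heq
    | succ m ih => simpa only [add_assoc] using hsucc _ _ ih
    | pred m ih =>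
      refine hpred _ _ ?_
      simpa only [add_assoc, sub_add_cancel] using ih
  have h1 := congrFun (hext _ _ (hall (x - k - i))) (Fin.last k)
  simp only [window, Fin.val_last] at h1
  push_cast [Nat.cast_sub hlt.le]
  rw [show x + ((i' : ℤ) - i) = i' + (x - k - i) + k by ring, ← h1]
  congr 1; ring

/-! ### Periodicity of rows from few ambiguous patterns -/

/-- A map identifying few elements has few values with several preimages. -/
theorem ncard_image_add_ncard_le {α β : Type*} (f : α → β) {S : Set α} (hS : S.Finite) :
    (f '' S).ncard + {b | ∃ a ∈ S, ∃ a' ∈ S, a ≠ a' ∧ f a = b ∧ f a' = b}.ncard ≤ S.ncard := by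
  set Q := {b | ∃ a ∈ S, ∃ a' ∈ S, a ≠ a' ∧ f a = b ∧ f a' = b} with hQ
  have h1 : ∀ b : f '' S, ∃ a ∈ S, f a = b := fun b => b.2
  -- `σ` picks one preimage of each value, and `τ` below a further one of each ambiguous value;
  -- their ranges are disjoint in `S`.
  choose σ hσS hσ using h1
  have h2 : ∀ b : Q, ∃ a ∈ S, f a = b ∧ ∀ c : f '' S, σ c ≠ a := by
    rintro ⟨b, a, ha, a', ha', hne, hab, hab'⟩
    by_cases h : σ ⟨b, a, ha, hab⟩ = a
    · refine ⟨a', ha', hab', fun c hc => hne ?_⟩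
      have : c = ⟨b, a, ha, hab⟩ := Subtype.ext ((hσ c).symm.trans ((congrArg f hc).trans hab'))
      rw [← h, ← this, hc]
    · refine ⟨a, ha, hab, fun c hc => h ?_⟩
      have : c = ⟨b, a, ha, hab⟩ := Subtype.ext ((hσ c).symm.trans ((congrArg f hc).trans hab))
      rw [← this, hc]
  choose τ hτS hτ hστ using h2
  have hσi : Function.Injective σ := fun b c h => Subtype.ext (by rw [← hσ b, h, hσ])
  have hτi : Function.Injective τ := fun b c h => Subtype.ext (by rw [← hτ b, h, hτ])
  have hσf : (Set.range σ).Finite := hS.subset (Set.range_subset_iff.2 hσS)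
  have hτf : (Set.range τ).Finite := hS.subset (Set.range_subset_iff.2 hτS)
  rw [← Nat.card_coe_set_eq, ← Nat.card_coe_set_eq Q, ← Nat.card_range_of_injective hσi,
    ← Nat.card_range_of_injective hτi, Nat.card_coe_set_eq, Nat.card_coe_set_eq,
    ← Set.ncard_union_eq ?_ hσf hτf]
  · exact Set.ncard_le_ncard (Set.union_subset (Set.range_subset_iff.2 hσS)
      (Set.range_subset_iff.2 hτS)) hS
  · rw [Set.disjoint_left]
    rintro _ ⟨c, rfl⟩ ⟨b, hb⟩
    exact hστ b c hb.symm

/-- The data extracted from a convex set of few patterns that is used to show that the rows of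
certain configurations are periodic. The top row `{0, …, m} × {0}` of the set has been removed. -/
structure Generator {A : Type*} (Y : Set (Configuration A)) (R : Finset (ℤ × ℤ)) (m h : ℕ)
    (l : ℤ → ℤ) : Prop where
  bounds : ∀ p ∈ R, -(h : ℤ) ≤ p.2 ∧ p.2 < 0
  right : ∀ c ∈ Y, ∀ c' ∈ Y, (∀ p ∈ R, c p = c' p) →
    (∀ i : ℤ, 0 ≤ i → i < m → c (i, 0) = c' (i, 0)) → c (m, 0) = c' (m, 0)
  left : ∀ c ∈ Y, ∀ c' ∈ Y, (∀ p ∈ R, c p = c' p) →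
    (∀ i : ℤ, 0 < i → i ≤ m → c (i, 0) = c' (i, 0)) → c (0, 0) = c' (0, 0)
  few : {q : R → A | ∃ c ∈ Y, ∃ c' ∈ Y, (∀ p, c p.1 = q p) ∧ (∀ p, c' p.1 = q p) ∧
    ∃ i : ℤ, 0 ≤ i ∧ i ≤ m ∧ c (i, 0) ≠ c' (i, 0)}.ncard ≤ m
  rows : ∀ j : ℤ, -(h : ℤ) ≤ j → j < 0 → ∀ i : ℤ, 0 ≤ i → i < m → (l j + i, j) ∈ R

section Generator

variable {A : Type*} {Y : Set (Configuration A)} {R : Finset (ℤ × ℤ)} {m h : ℕ} {l : ℤ → ℤ}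

theorem Generator.row_determined (hY : IsSubshift Y) (hG : Generator Y R m h l)
    {c c' : Configuration A} (hc : c ∈ Y) (hc' : c' ∈ Y)
    (hstripe : ∀ x j : ℤ, -(h : ℤ) ≤ j → j < 0 → c (x, j) = c' (x, j)) {x₀ : ℤ}
    (hwin : ∀ i : ℤ, 0 ≤ i → i < m → c (x₀ + i, 0) = c' (x₀ + i, 0)) (x : ℤ) :
    c (x, 0) = c' (x, 0) := by
  have hR : ∀ y : ℤ, ∀ p ∈ R, c (p + (y, 0)) = c' (p + (y, 0)) := by
    intro y p hp
    obtain ⟨h1, h2⟩ := hG.bounds p hp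
    have := hstripe (p.1 + y) p.2 h1 h2
    rwa [show p + (y, 0) = (p.1 + y, p.2) by ext <;> simp]
  have hright : ∀ k : ℕ, ∀ i : ℤ, 0 ≤ i → i < m + k → c (x₀ + i, 0) = c' (x₀ + i, 0) := by
    intro k
    induction k with
    | zero => simpa using hwin
    | succ k ih =>
      intro i h1 h2
      push_cast at h2
      by_cases h3 : i < m + k
      · exact ih i h1 h3
      · have h4 := hG.right _ (hY.shift_mem c hc (x₀ + k, 0)) _ (hY.shift_mem c' hc' (x₀ + k, 0))
          (hR _) (by
            intro j hj hj'
            have := ih (k + j) (by omega) (by omega)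
            simp only [Prod.mk_add_mk, add_zero]
            rwa [show j + (x₀ + k) = x₀ + (k + j) by ring])
        simp only [Prod.mk_add_mk, add_zero] at h4
        rwa [show x₀ + i = m + (x₀ + k) by omega]
  have hleft : ∀ k : ℕ, ∀ i : ℤ, -(k : ℤ) ≤ i → i < m → c (x₀ + i, 0) = c' (x₀ + i, 0) := by
    intro k
    induction k with
    | zero => simpa using hwin
    | succ k ih =>
      intro i h1 h2
      push_cast at h1
      by_cases h3 : -(k : ℤ) ≤ i
      · exact ih i h3 h2
      · have h4 := hG.left _ (hY.shift_mem c hc (x₀ + i, 0)) _ (hY.shift_mem c' hc' (x₀ + i, 0))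
          (hR _) (by
            intro j hj hj'
            have := ih (i + j) (by omega) (by omega)
            simp only [Prod.mk_add_mk, add_zero]
            rwa [show j + (x₀ + i) = x₀ + (i + j) by ring])
        simpa using h4
  rcases lt_or_ge x x₀ with hx | hx
  · have := hleft (x₀ - x).toNat (x - x₀) (by omega) (by omega)
    simpa using this
  · have := hright (x - x₀ + 1).toNat (x - x₀) (by omega) (by omega)
    simpa using this

/-- Every horizontal translate of `R` shows one of the at most $m$ ambiguous patterns. Row $j$ of
`R` holds $m$ consecutive cells, so row $j$ of `c` has at most $m$ words of length $m$ and a period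
at most $m$, which divides $m!$. -/
theorem Generator.stripe_periodic [Finite A] (hY : IsSubshift Y) (hG : Generator Y R m h l)
    {c : Configuration A} (hc : c ∈ Y)
    (hext : ∀ x : ℤ, ∃ c' ∈ Y, (∀ p ∈ R, c (p + (x, 0)) = c' (p + (x, 0))) ∧
      ∃ i : ℤ, 0 ≤ i ∧ i ≤ m ∧ c (x + i, 0) ≠ c' (x + i, 0)) {j : ℤ} (hj : -(h : ℤ) ≤ j)
    (hj0 : j < 0) : Function.Periodic (fun x => c (x, j)) (m.factorial : ℤ) := by
  have hmem : ∀ x : ℤ, (fun p : R => c (p.1 + (x, 0))) ∈ {q : R → A | ∃ c ∈ Y, ∃ c' ∈ Y,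
      (∀ p, c p.1 = q p) ∧ (∀ p, c' p.1 = q p) ∧
      ∃ i : ℤ, 0 ≤ i ∧ i ≤ m ∧ c (i, 0) ≠ c' (i, 0)} := by
    intro x
    obtain ⟨c', hc', h1, i, hi0, him, hi⟩ := hext x
    refine ⟨_, hY.shift_mem c hc (x, 0), _, hY.shift_mem c' hc' (x, 0), fun p => rfl,
      fun p => (h1 p p.2).symm, i, hi0, him, ?_⟩
    simpa [add_comm] using hi
  have hwin : (Set.range (window (fun x => c (l j + x, j)) m)).ncard ≤ m := by
    refine le_trans (Set.ncard_le_ncard ?_ (Set.toFinite _)) (le_trans (Set.ncard_image_le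
      (f := fun (q : R → A) (i : Fin m) => q ⟨(l j + (i : ℤ), j), hG.rows j hj hj0 i (by omega)
        (by omega)⟩) (Set.toFinite _)) hG.few)
    rintro _ ⟨x, rfl⟩
    refine ⟨_, hmem x, ?_⟩
    funext i
    simp only [window, Prod.mk_add_mk, add_zero]
    congr 2; ring
  obtain ⟨q, hq0, hqm, hq⟩ := exists_period_of_ncard_window_le _ hwin
  obtain ⟨k, hk⟩ := Nat.dvd_factorial hq0 hqm
  have h1 : Function.Periodic (fun x => c (l j + x, j)) (m.factorial : ℤ) := by
    have := hq.nat_mul k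
    rwa [hk, Nat.cast_mul, mul_comm]
  intro x
  have h2 := h1 (x - l j)
  simp only [add_sub_cancel] at h2
  simp only
  rw [← h2]
  congr 2; ring

/-- If some translate of `R` determines its extension, `c` and its translate by $N$ agree on a
window and hence on the row. Otherwise the stripe has period $m!$, and a repeated window at
multiples of $m!$ gives a row period dividing $N$. The period does not grow, so the step can be
iterated. -/
theorem Generator.row_periodic [Finite A] (hY : IsSubshift Y) (hG : Generator Y R m h l)
    {N : ℕ} (hN : N = m.factorial * (Nat.card (Fin m → A)).factorial)
    {c : Configuration A} (hc : c ∈ Y)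
    (hstripe : ∀ j : ℤ, -(h : ℤ) ≤ j → j < 0 → Function.Periodic (fun x => c (x, j)) (N : ℤ)) :
    Function.Periodic (fun x => c (x, 0)) (N : ℤ) := by
  by_cases hcase : ∃ x : ℤ, ∀ c' ∈ Y, (∀ p ∈ R, c (p + (x, 0)) = c' (p + (x, 0))) →
      ∀ i : ℤ, 0 ≤ i → i ≤ m → c (x + i, 0) = c' (x + i, 0)
  · obtain ⟨x, hx⟩ := hcase
    have hc' := hY.shift_mem c hc ((N : ℤ), 0)
    have h1 := hx _ hc' (by
      intro p hp
      obtain ⟨h1, h2⟩ := hG.bounds p hp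
      have h3 := hstripe p.2 h1 h2 (p.1 + x)
      simp only at h3
      rw [show p + (x, 0) = (p.1 + x, p.2) by ext <;> simp, Prod.mk_add_mk, add_zero, h3])
    intro y
    have h2 := hG.row_determined hY hc hc' (fun x j h1 h2 => by
      simpa using (hstripe j h1 h2 x).symm) (fun i h3 h4 => h1 i h3 h4.le) y
    simpa using h2.symm
  · push Not at hcase
    have hper : ∀ j : ℤ, -(h : ℤ) ≤ j → j < 0 →
        Function.Periodic (fun x => c (x, j)) (m.factorial : ℤ) := by
      intro j hj hj0
      refine hG.stripe_periodic hY hc (fun x => ?_) hj hj0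
      obtain ⟨c', hc', h1, i, h2⟩ := hcase x
      exact ⟨c', hc', h1, i, h2⟩
    obtain ⟨k, hk, k', hk', hne, heq⟩ := Set.exists_ne_map_eq_of_ncard_lt_of_maps_to
      (s := Set.Icc 0 (Nat.card (Fin m → A))) (t := Set.univ)
      (f := fun (k : ℕ) (i : Fin m) => c (k * m.factorial + i, 0))
      (by
        rw [Set.ncard_univ, ← Finset.coe_Icc, Set.ncard_coe_finset, Nat.card_Icc]
        omega)
      (fun i _ => Set.mem_univ _)
    wlog hlt : k < k' generalizing k k'
    · exact this k' hk' k hk hne.symm heq.symm (lt_of_le_of_ne (not_lt.1 hlt) hne.symm)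
    have hc' := hY.shift_mem c hc (((k' - k : ℕ) : ℤ) * m.factorial, 0)
    have hrow := hG.row_determined hY hc hc' (fun x j h1 h2 => by
        simpa using ((hper j h1 h2).nat_mul (k' - k) x).symm) (x₀ := k * m.factorial) (by
      intro i hi him
      have h1 := congrFun heq ⟨i.toNat, by omega⟩
      simp only [Int.toNat_of_nonneg hi] at h1
      rw [h1]
      simp only [Prod.mk_add_mk, add_zero]
      congr 2
      push_cast [Nat.cast_sub hlt.le]
      ring)
    have hper' : Function.Periodic (fun x => c (x, 0)) (((k' - k : ℕ) : ℤ) * m.factorial) :=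
      fun x => by simpa using (hrow x).symm
    obtain ⟨q, hq⟩ := Nat.dvd_factorial (m := k' - k) (n := Nat.card (Fin m → A)) (by omega)
      (by have := hk'.2; omega)
    have h2 := hper'.nat_mul q
    have h3 : (N : ℤ) = (q : ℤ) * (((k' - k : ℕ) : ℤ) * m.factorial) := by
      rw [hN, hq, Nat.cast_mul, Nat.cast_mul]; ring
    rwa [h3]

/-- If a generator exists and two configurations agree exactly below a row, then there is a
horizontally periodic configuration. -/
theorem Generator.exists_periodic [Finite A] (hY : IsSubshift Y) (hG : Generator Y R m h l)
    {d d' : Configuration A} (hd : d ∈ Y) (hd' : d' ∈ Y)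
    (hag : ∀ p : ℤ × ℤ, p.2 < 0 → d p = d' p) (hne : d 0 ≠ d' 0) :
    ∃ c ∈ Y, ∃ t : ℤ × ℤ, t ≠ 0 ∧ ∀ p, c (p + t) = c p := by
  set N : ℕ := m.factorial * (Nat.card (Fin m → A)).factorial with hN
  -- If `d` and `d'` agreed on some window of row $0$, they would agree on the whole row; hence
  -- every position is ambiguous.
  have hstart : ∀ j : ℤ, -(h : ℤ) ≤ j → j < 0 → Function.Periodic (fun x => d (x, j)) (N : ℤ) := by
    intro j hj hj0
    have h1 := hG.stripe_periodic hY hd (fun x => ⟨d', hd', fun p hp => hag _ (by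
      simpa using (hG.bounds p hp).2), by
        by_contra! hcon
        exact hne (hG.row_determined hY hd hd' (fun x j _ hj => hag _ hj)
          (fun i h1 h2 => hcon i h1 h2.le) 0)⟩) hj hj0
    have h2 := h1.nat_mul (Nat.card (Fin m → A)).factorial
    rwa [hN, mul_comm, Nat.cast_mul]
  have hall : ∀ k : ℕ, ∀ j : ℤ, -(h : ℤ) ≤ j → j < k →
      Function.Periodic (fun x => d (x, j)) (N : ℤ) := by
    intro k
    induction k with
    | zero => simpa using hstart
    | succ k ih =>
      intro j hj hjk
      push_cast at hjk
      by_cases h1 : j < k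
      · exact ih j hj h1
      · have h2 := hG.row_periodic hY hN (hY.shift_mem d hd (0, (k : ℤ))) (fun j hj hj0 => by
          simpa using ih (j + k) (by omega) (by omega))
        have h3 : j = k := by omega
        subst h3
        simpa using h2
  have hle : (hyperfilter ℕ : Filter ℕ) ≤ atTop := by
    rw [← Nat.cofinite_eq_atTop]; exact hyperfilter_le_cofinite
  obtain ⟨c, hc⟩ := exists_ultrafilter_limit (hyperfilter ℕ)
    fun (k : ℕ) (p : ℤ × ℤ) => d (p + (0, (k : ℤ)))
  have hN0 : N ≠ 0 := mul_ne_zero (Nat.factorial_ne_zero _) (Nat.factorial_ne_zero _)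
  refine ⟨c, hY.limit_mem (Eventually.of_forall fun k => hY.shift_mem d hd _) hc, ((N : ℤ), 0),
    by simpa using hN0, fun p => ?_⟩
  obtain ⟨k, h1, h2, h3⟩ := ((hc p).and ((hc (p + ((N : ℤ), 0))).and
    (hle (eventually_ge_atTop (-h - p.2).toNat)))).exists
  rw [← h1, ← h2]
  have h4 := hall (p.2 + k + 1).toNat (p.2 + k) (by omega) (by omega) p.1
  simp only at h4
  rw [show p + ((N : ℤ), 0) + (0, (k : ℤ)) = (p.1 + N, p.2 + k) by ext <;> simp, h4,
    show p + (0, (k : ℤ)) = (p.1, p.2 + k) by ext <;> simp]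

end Generator

/-! ### Convex shapes of minimal size with few patterns -/

/-- The integer points of a convex set of the plane. -/
def LatticeConvex (B : Finset (ℤ × ℤ)) : Prop :=
  ∃ C : Set (ℝ × ℝ), Convex ℝ C ∧ ∀ p : ℤ × ℤ, p ∈ B ↔ ((p.1 : ℝ), (p.2 : ℝ)) ∈ C

theorem latticeConvex_rectangle (n m : ℕ) : LatticeConvex (rectangle n m) := by
  refine ⟨Set.Icc (1, 1) (n, m), convex_Icc _ _, fun p => ?_⟩
  simp only [rectangle, Finset.mem_product, Finset.mem_Icc, Set.mem_Icc, Prod.mk_le_mk]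
  norm_cast
  tauto

theorem LatticeConvex.image_affine {B : Finset (ℤ × ℤ)} (hB : LatticeConvex B)
    (φ : ℤ × ℤ ≃+ ℤ × ℤ) (v : ℤ × ℤ) : LatticeConvex (B.image fun p => φ p + v) := by
  obtain ⟨C, hC, hBC⟩ := hB
  set α := φ.symm (1, 0) with hα
  set β := φ.symm (0, 1) with hβ
  have hφ : ∀ q : ℤ × ℤ, φ.symm q = q.1 • α + q.2 • β := by
    intro q
    rw [hα, hβ, ← map_zsmul, ← map_zsmul, ← map_add]
    congr 1
    ext <;> simp
  refine ⟨{z : ℝ × ℝ | ((z.1 - v.1) * α.1 + (z.2 - v.2) * β.1,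
    (z.1 - v.1) * α.2 + (z.2 - v.2) * β.2) ∈ C}, ?_, fun q => ?_⟩
  · intro z hz w hw a b ha hb hab
    have h := hC hz hw ha hb hab
    have hb' : b = 1 - a := by linarith
    subst hb'
    simp only [Set.mem_ofPred_eq]
    convert h using 1
    ext <;> simp only [Prod.fst_add, Prod.snd_add, Prod.smul_fst, Prod.smul_snd, smul_eq_mul] <;>
      ring
  · have h1 : q ∈ B.image (fun p => φ p + v) ↔ φ.symm (q - v) ∈ B := by
      rw [Finset.mem_image]
      constructor
      · rintro ⟨p, hp, rfl⟩; simpa using hp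
      · intro h; exact ⟨_, h, by simp⟩
    rw [h1, hBC, hφ, Set.mem_ofPred_eq]
    simp

/-- Intersecting with this set, for $s=\pm1$, removes a single endpoint of the top row and keeps the
shape convex. -/
theorem convex_lex_halfPlane (s k : ℝ) :
    Convex ℝ {z : ℝ × ℝ | z.2 < 0 ∨ (z.2 = 0 ∧ s * z.1 < k)} := by
  intro z hz w hw a b ha hb hab
  rcases ha.eq_or_lt with rfl | ha
  · simpa [show b = 1 by linarith] using hw
  rcases hb.eq_or_lt with rfl | hb
  · simpa [show a = 1 by linarith] using hz
  simp only [Set.mem_ofPred_eq, Prod.fst_add, Prod.snd_add, Prod.smul_fst, Prod.smul_snd,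
    smul_eq_mul] at hz hw ⊢
  rcases hz with hz | ⟨hz, hz'⟩ <;> rcases hw with hw | ⟨hw, hw'⟩
  · left; nlinarith
  · left; rw [hw]; nlinarith
  · left; rw [hz]; nlinarith
  · right
    refine ⟨by rw [hz, hw]; ring, ?_⟩
    have hk : k = a * k + b * k := by rw [← add_mul, hab, one_mul]
    rw [hk]
    nlinarith

/-- The number of patterns of shape `B` in the configurations of `Y`. -/
noncomputable def patternCount {A : Type*} (Y : Set (Configuration A)) (B : Finset (ℤ × ℤ)) : ℕ :=
  ((fun (c : Configuration A) (p : B) => c p) '' Y).ncard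

theorem patternCount_image {A : Type*} (Y : Set (Configuration A)) (B : Finset (ℤ × ℤ))
    (T : ℤ × ℤ → ℤ × ℤ) :
    patternCount ((fun c => c ∘ T) '' Y) B = patternCount Y (B.image T) := by
  set r : (B.image T → A) → B → A := fun q p => q ⟨T p, Finset.mem_image_of_mem T p.2⟩ with hr
  have hinj : Function.Injective r := by
    intro q q' h
    funext ⟨x, hx⟩
    obtain ⟨p, hp, rfl⟩ := Finset.mem_image.1 hx
    exact congrFun h ⟨p, hp⟩
  rw [patternCount, patternCount, ← Set.ncard_image_of_injective _ hinj, Set.image_image,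
    Set.image_image]
  rfl

/-- A convex set `B` with at most `|B|` patterns, of minimal size. -/
structure IsMinimalLow {A : Type*} (Y : Set (Configuration A)) (B : Finset (ℤ × ℤ)) : Prop where
  convex : LatticeConvex B
  low : patternCount Y B ≤ B.card
  minimal : ∀ B', LatticeConvex B' → B'.card < B.card → B'.card < patternCount Y B'

theorem exists_isMinimalLow {A : Type*} {Y : Set (Configuration A)} {D : Finset (ℤ × ℤ)}
    (hD : LatticeConvex D) (hlow : patternCount Y D ≤ D.card) : ∃ B, IsMinimalLow Y B := by
  obtain ⟨B, hB, hmin⟩ := WellFounded.has_min (measure (Finset.card (α := ℤ × ℤ))).wf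
    {B | LatticeConvex B ∧ patternCount Y B ≤ B.card} ⟨D, hD, hlow⟩
  refine ⟨B, hB.1, hB.2, fun B' hB' hlt => ?_⟩
  by_contra! hcon
  exact hmin B' ⟨hB', hcon⟩ hlt

theorem card_image_affine (B : Finset (ℤ × ℤ)) (φ : ℤ × ℤ ≃+ ℤ × ℤ) (v : ℤ × ℤ) :
    (B.image fun p => φ p + v).card = B.card :=
  Finset.card_image_of_injective _ fun _ _ h => φ.injective (add_right_cancel h)

theorem IsMinimalLow.translate {A : Type*} {Y : Set (Configuration A)} (hY : IsSubshift Y)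
    {B : Finset (ℤ × ℤ)} (hB : IsMinimalLow Y B) (v : ℤ × ℤ) :
    IsMinimalLow Y (B.image fun p => AddEquiv.refl (ℤ × ℤ) p + v) where
  convex := hB.convex.image_affine _ v
  low := by
    rw [card_image_affine, ← patternCount_image]
    convert hB.low
    ext c
    constructor
    · rintro ⟨c, hc, rfl⟩; exact hY.shift_mem c hc v
    · intro hc
      refine ⟨_, hY.shift_mem c hc (-v), ?_⟩
      funext p; simp
  minimal := by
    rw [card_image_affine]; exact hB.minimal

theorem IsMinimalLow.comp {A : Type*} {Y : Set (Configuration A)} {B : Finset (ℤ × ℤ)}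
    (hB : IsMinimalLow Y B) (φ : ℤ × ℤ ≃+ ℤ × ℤ) :
    IsMinimalLow ((fun c => c ∘ φ) '' Y) (B.image fun p => φ.symm p + 0) where
  convex := hB.convex.image_affine _ 0
  low := by
    rw [card_image_affine, patternCount_image, Finset.image_image]
    have : (φ ∘ fun p => φ.symm p + 0) = id := by funext p; simp
    rw [this, Finset.image_id]
    exact hB.low
  minimal := by
    intro B' hB' hcard
    rw [card_image_affine] at hcard
    have h1 := card_image_affine B' φ 0
    have h2 := hB.minimal _ (hB'.image_affine φ 0) (by rwa [h1])
    rw [h1] at h2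
    rw [patternCount_image]
    simpa using h2

theorem IsSubshift.comp {A : Type*} {Y : Set (Configuration A)} (hY : IsSubshift Y)
    (φ : ℤ × ℤ ≃+ ℤ × ℤ) : IsSubshift ((fun c => c ∘ φ) '' Y) where
  nonempty := hY.nonempty.image _
  shift_mem := by
    rintro _ ⟨c, hc, rfl⟩ t
    refine ⟨_, hY.shift_mem c hc (φ t), ?_⟩
    funext p; simp
  closed := by
    intro c hc
    refine ⟨c ∘ φ.symm, hY.closed _ fun F => ?_, by funext p; simp⟩
    obtain ⟨_, ⟨y, hy, rfl⟩, h⟩ := hc (F.image φ.symm)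
    refine ⟨y, hy, fun p hp => ?_⟩
    simpa using h _ (Finset.mem_image_of_mem _ hp)

theorem minimal_comp {A : Type*} {Y : Set (Configuration A)}
    (hmin : ∀ Z ⊆ Y, IsSubshift Z → Z = Y) (φ : ℤ × ℤ ≃+ ℤ × ℤ) :
    ∀ Z ⊆ (fun c : Configuration A => c ∘ φ) '' Y, IsSubshift Z →
      Z = (fun c : Configuration A => c ∘ φ) '' Y := by
  intro Z hZ hZs
  have h1 := hmin ((fun c : Configuration A => c ∘ φ.symm) '' Z) (by
    rintro _ ⟨z, hz, rfl⟩
    obtain ⟨y, hy, rfl⟩ := hZ hz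
    have : (y ∘ φ) ∘ φ.symm = y := by funext p; simp
    change (y ∘ φ) ∘ φ.symm ∈ Y
    rwa [this]) (hZs.comp φ.symm)
  rw [← h1, Set.image_image]
  have : ∀ z : Configuration A, (z ∘ φ.symm) ∘ φ = z := fun z => by funext p; simp
  simp [this]

section MinimalLow

variable {A : Type*} {Y : Set (Configuration A)} {B : Finset (ℤ × ℤ)}

theorem image_restrict_subset {B' : Finset (ℤ × ℤ)} (h : B' ⊆ B) :
    (fun (q : B → A) (p : B') => q ⟨p, h p.2⟩) '' ((fun (c : Configuration A) (p : B) => c p) '' Y)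
      = (fun (c : Configuration A) (p : B') => c p) '' Y := by
  rw [Set.image_image]

variable [Finite A]

/-- By minimality `B.erase e` has at least $|B|$ patterns, hence as many as `B`, and restriction is
injective. -/
theorem IsMinimalLow.determined (hB : IsMinimalLow Y B) {e : ℤ × ℤ} (he : e ∈ B)
    (hconv : LatticeConvex (B.erase e)) {c c' : Configuration A} (hc : c ∈ Y) (hc' : c' ∈ Y)
    (h : ∀ p ∈ B.erase e, c p = c' p) : c e = c' e := by
  have hcard := Finset.card_erase_add_one he
  have h1 := hB.minimal _ hconv (by omega)
  have h2 := image_restrict_subset (Y := Y) (Finset.erase_subset e B)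
  have h3 := hB.low
  have h4 : (((fun (q : B → A) (p : B.erase e) => q ⟨p, Finset.erase_subset e B p.2⟩) ''
      ((fun (c : Configuration A) (p : B) => c p) '' Y))).ncard
      = ((fun (c : Configuration A) (p : B) => c p) '' Y).ncard := by
    refine le_antisymm (Set.ncard_image_le (Set.toFinite _)) ?_
    rw [h2]
    unfold patternCount at h1 h3
    omega
  have h5 := Set.injOn_of_ncard_image_eq h4 (Set.toFinite _) ⟨c, hc, rfl⟩ ⟨c', hc', rfl⟩
    (by funext p; exact h p p.2)
  exact congrFun h5 ⟨e, he⟩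

theorem mem_row_of_convex {C : Set (ℝ × ℝ)} (hC : Convex ℝ C) {x y k s : ℝ} (hk : 0 < k)
    (h0 : (x, y) ∈ C) (h1 : (x + k, y) ∈ C) (hs : 0 ≤ s) (hsk : s ≤ k) : (x + s, y) ∈ C := by
  have h2 : s / k ≤ 1 := (div_le_one hk).2 hsk
  have h := hC h0 h1 (sub_nonneg.2 h2) (div_nonneg hs hk.le) (by ring)
  convert h using 1
  ext
  · simp only [Prod.fst_add, Prod.smul_fst, smul_eq_mul]; field_simp; ring
  · simp only [Prod.snd_add, Prod.smul_snd, smul_eq_mul]; ring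

theorem LatticeConvex.exists_row (hB : LatticeConvex B) {x₀ j : ℤ} (h : (x₀, j) ∈ B) :
    ∃ a b : ℤ, a ≤ b ∧ ∀ x, (x, j) ∈ B ↔ a ≤ x ∧ x ≤ b := by
  obtain ⟨C, hC, hBC⟩ := hB
  set S := (B.filter fun p => p.2 = j).image Prod.fst with hS
  have hmem : ∀ x, x ∈ S ↔ (x, j) ∈ B := by
    intro x
    simp [hS]
  have hne : S.Nonempty := ⟨x₀, (hmem x₀).2 h⟩
  refine ⟨S.min' hne, S.max' hne, S.min'_le_max' hne, fun x => ⟨fun hx =>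
    ⟨S.min'_le x ((hmem x).2 hx), S.le_max' x ((hmem x).2 hx)⟩, fun ⟨h1, h2⟩ => ?_⟩⟩
  have h3 := (hBC _).1 ((hmem _).1 (S.min'_mem hne))
  have h4 := (hBC _).1 ((hmem _).1 (S.max'_mem hne))
  rw [hBC]
  have h1' : ((S.min' hne : ℤ) : ℝ) ≤ x := by exact_mod_cast h1
  have h2' : (x : ℝ) ≤ (S.max' hne : ℤ) := by exact_mod_cast h2
  rcases h1'.eq_or_lt with h5 | h5
  · rw [← h5]; exact h3
  · have := mem_row_of_convex hC (k := (S.max' hne : ℤ) - (S.min' hne : ℤ)) (s := x - (S.min' hne : ℤ))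
      (by linarith) h3 (by simpa using h4) (by linarith) (by linarith)
    simpa using this

/-- Interpolating between the two segments puts a real segment of length $m$ in every intermediate
row; rounding its left end up still leaves $m$ integer points, possibly not $m+1$. -/
theorem LatticeConvex.rows_of_top_le_bottom (hB : LatticeConvex B) {h m : ℕ} {b : ℤ}
    (h0 : (0, 0) ∈ B) (h1 : ((m : ℤ), 0) ∈ B) (h2 : (b, -(h : ℤ)) ∈ B)
    (h3 : (b + m, -(h : ℤ)) ∈ B) (j : ℤ) (hj : -(h : ℤ) ≤ j) (hj0 : j < 0) :
    ∃ l : ℤ, ∀ i : ℤ, 0 ≤ i → i < m → (l + i, j) ∈ B := by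
  obtain ⟨C, hC, hBC⟩ := hB
  have hh : (0 : ℝ) < h := by
    have : 0 < (h : ℤ) := by omega
    exact_mod_cast this
  rw [hBC] at h0 h1 h2 h3
  push_cast at h0 h1 h2 h3
  have hjR : -(h : ℝ) ≤ j := by exact_mod_cast hj
  have hj0R : (j : ℝ) < 0 := by exact_mod_cast hj0
  set t : ℝ := -j / h with ht
  have ht0 : 0 ≤ t := div_nonneg (by linarith) hh.le
  have ht1 : t ≤ 1 := (div_le_one hh).2 (by linarith)
  have hth : t * h = -j := by rw [ht]; field_simp
  refine ⟨⌈t * b⌉, fun i hi him => ?_⟩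
  rw [hBC]
  push_cast
  have hc1 := Int.le_ceil (t * (b : ℝ))
  have hc2 := Int.ceil_lt_add_one (t * (b : ℝ))
  have hi' : (0 : ℝ) ≤ i := by exact_mod_cast hi
  have him' : (i : ℝ) + 1 ≤ m := by exact_mod_cast him
  set s : ℝ := ⌈t * (b : ℝ)⌉ + i - t * b with hs
  have hs0 : 0 ≤ s := by linarith
  have hsm : s ≤ m := by linarith
  have hm : (0 : ℝ) < m := by linarith
  have h4 := mem_row_of_convex hC hm h0 (by simpa using h1) hs0 hsm
  have h5 := mem_row_of_convex hC hm h2 h3 hs0 hsm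
  have h6 := hC h4 h5 (sub_nonneg.2 ht1) ht0 (by ring)
  convert h6 using 1
  ext
  · simp only [Prod.fst_add, Prod.smul_fst, smul_eq_mul]; rw [hs]; ring
  · simp only [Prod.snd_add, Prod.smul_snd, smul_eq_mul]; linarith

/-- Without its top row `B` has $|B|-m-1$ cells, hence at least $|B|-m$ patterns, while `B` has at
most $|B|$. The excess bounds the ambiguous patterns. -/
theorem IsMinimalLow.few_extensions (hB : IsMinimalLow Y B) {m : ℕ}
    (htop : ∀ p ∈ B, p.2 ≤ 0) (hrow : ∀ x : ℤ, (x, 0) ∈ B ↔ 0 ≤ x ∧ x ≤ m) :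
    {q : B.filter (fun p => p.2 < 0) → A | ∃ c ∈ Y, ∃ c' ∈ Y, (∀ p, c p.1 = q p) ∧
      (∀ p, c' p.1 = q p) ∧ ∃ i : ℤ, 0 ≤ i ∧ i ≤ m ∧ c (i, 0) ≠ c' (i, 0)}.ncard ≤ m := by
  set R := B.filter (fun p => p.2 < 0) with hR
  have hRB : R ⊆ B := Finset.filter_subset _ _
  have hcard : R.card + (m + 1) = B.card := by
    rw [← Finset.card_filter_add_card_filter_not (s := B) (fun p => p.2 < 0)]
    congr 1
    have : B.filter (fun p => ¬ p.2 < 0) = (Finset.Icc (0 : ℤ) m).image fun x => (x, (0 : ℤ)) := by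
      ext ⟨x, y⟩
      simp only [Finset.mem_filter, Finset.mem_image, Finset.mem_Icc, Prod.mk.injEq]
      constructor
      · rintro ⟨hp, hy⟩
        have hy0 : y = 0 := le_antisymm (htop _ hp) (not_lt.1 hy)
        subst hy0
        exact ⟨x, (hrow x).1 hp, rfl, rfl⟩
      · rintro ⟨x, hx, rfl, rfl⟩
        exact ⟨(hrow x).2 hx, lt_irrefl _⟩
    rw [this, Finset.card_image_of_injective _ (fun x y h => congrArg Prod.fst h), Int.card_Icc]
    omega
  have hconv : LatticeConvex R := by
    obtain ⟨C, hC, hBC⟩ := hB.convex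
    refine ⟨C ∩ {z | z.2 < 0}, hC.inter (convex_halfSpace_lt (IsLinearMap.mk
      (fun _ _ => rfl) (fun _ _ => rfl)) 0), fun p => ?_⟩
    simp [hR, hBC]
  have h1 := hB.minimal R hconv (by omega)
  have h2 := ncard_image_add_ncard_le (fun (q : B → A) (p : R) => q ⟨p, hRB p.2⟩)
    (Set.toFinite ((fun (c : Configuration A) (p : B) => c p) '' Y))
  rw [image_restrict_subset hRB] at h2
  have h3 := hB.low
  unfold patternCount at h1 h3
  refine le_trans (Set.ncard_le_ncard (t := {b | ∃ a ∈ (fun (c : Configuration A) (p : B) => c p) '' Y,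
    ∃ a' ∈ (fun (c : Configuration A) (p : B) => c p) '' Y, a ≠ a' ∧
      (fun p : R => a ⟨p, hRB p.2⟩) = b ∧ (fun p : R => a' ⟨p, hRB p.2⟩) = b}) ?_ (Set.toFinite _))
    (by omega)
  rintro q ⟨c, hc, c', hc', hq, hq', i, hi0, him, hi⟩
  exact ⟨_, ⟨c, hc, rfl⟩, _, ⟨c', hc', rfl⟩,
    fun h => hi (congrFun h ⟨(i, 0), (hrow i).2 ⟨hi0, him⟩⟩), funext hq, funext hq'⟩

theorem IsMinimalLow.exists_generator (hB : IsMinimalLow Y B) {h m : ℕ} {b : ℤ}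
    (htop : ∀ p ∈ B, p.2 ≤ 0) (hrow : ∀ x : ℤ, (x, 0) ∈ B ↔ 0 ≤ x ∧ x ≤ m)
    (hbot : ∀ p ∈ B, -(h : ℤ) ≤ p.2) (h2 : (b, -(h : ℤ)) ∈ B) (h3 : (b + m, -(h : ℤ)) ∈ B) :
    ∃ l, Generator Y (B.filter fun p => p.2 < 0) m h l := by
  have h0 : ((0 : ℤ), (0 : ℤ)) ∈ B := (hrow 0).2 ⟨le_rfl, by omega⟩
  have h1 : ((m : ℤ), (0 : ℤ)) ∈ B := (hrow m).2 ⟨by omega, le_rfl⟩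
  have herase : ∀ (s : ℝ) (k : ℤ), (∀ x : ℤ, 0 ≤ x → x ≤ m → (s * x < s * k ↔ x ≠ k)) →
      LatticeConvex (B.erase (k, 0)) := by
    intro s k hk
    obtain ⟨C, hC, hBC⟩ := hB.convex
    refine ⟨C ∩ _, hC.inter (convex_lex_halfPlane s (s * k)), fun p => ?_⟩
    rw [Finset.mem_erase, Set.mem_inter_iff, ← hBC, and_comm, and_congr_right_iff]
    intro hp
    obtain ⟨x, y⟩ := p
    have hy := htop _ hp
    simp only [Set.mem_ofPred_eq, Int.cast_lt_zero, Int.cast_eq_zero, ne_eq, Prod.mk.injEq]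
    simp only at hy
    rcases hy.eq_or_lt with rfl | hy
    · obtain ⟨hx0, hxm⟩ := (hrow x).1 hp
      simp [hk x hx0 hxm]
    · simp [hy, hy.ne]
  have hl : ∀ j : ℤ, ∃ l : ℤ, -(h : ℤ) ≤ j → j < 0 → ∀ i : ℤ, 0 ≤ i → i < m → (l + i, j) ∈ B := by
    intro j
    by_cases hj : -(h : ℤ) ≤ j ∧ j < 0
    · obtain ⟨l, hl⟩ := hB.convex.rows_of_top_le_bottom h0 h1 h2 h3 j hj.1 hj.2
      exact ⟨l, fun _ _ => hl⟩
    · exact ⟨0, fun hj1 hj2 => absurd ⟨hj1, hj2⟩ hj⟩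
  choose l hl using hl
  have hsplit : ∀ c c' : Configuration A, (∀ p ∈ B.filter fun p => p.2 < 0, c p = c' p) →
      ∀ k : ℤ, (∀ i : ℤ, 0 ≤ i → i ≤ m → i ≠ k → c (i, 0) = c' (i, 0)) →
      ∀ p ∈ B.erase (k, 0), c p = c' p := by
    rintro c c' hR k hi ⟨x, y⟩ hp
    obtain ⟨hpk, hp⟩ := Finset.mem_erase.1 hp
    have hy := htop _ hp
    simp only at hy
    rcases hy.eq_or_lt with rfl | hy
    · obtain ⟨hx0, hxm⟩ := (hrow x).1 hp
      exact hi x hx0 hxm fun h => hpk (by rw [h])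
    · exact hR _ (Finset.mem_filter.2 ⟨hp, hy⟩)
  refine ⟨l, ⟨fun p hp => ?_, ?_, ?_, hB.few_extensions htop hrow, fun j hj hj0 i hi him => ?_⟩⟩
  · obtain ⟨hp, hp0⟩ := Finset.mem_filter.1 hp
    exact ⟨hbot p hp, hp0⟩
  · intro c hc c' hc' hR hi
    refine hB.determined h1 (herase 1 m fun x hx0 hxm => ?_) hc hc' (hsplit c c' hR m
      fun i hi0 him hne => hi i hi0 (lt_of_le_of_ne him hne))
    rw [one_mul, one_mul, Int.cast_lt]
    omega
  · intro c hc c' hc' hR hi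
    refine hB.determined h0 (herase (-1) 0 fun x hx0 hxm => ?_) hc hc' (hsplit c c' hR 0
      fun i hi0 him hne => hi i (lt_of_le_of_ne hi0 hne.symm) him)
    rw [neg_one_mul, neg_one_mul, neg_lt_neg_iff, Int.cast_lt]
    omega
  · exact Finset.mem_filter.2 ⟨hl j hj hj0 i hi him, hj0⟩

theorem IsMinimalLow.nonempty (hY : Y.Nonempty) (hB : IsMinimalLow Y B) : B.Nonempty := by
  rw [← Finset.card_pos]
  refine lt_of_lt_of_le ?_ hB.low
  rw [patternCount, Set.ncard_pos]
  exact hY.image _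

theorem IsMinimalLow.exists_periodic_of_top_le_bottom (hY : IsSubshift Y) (hB : IsMinimalLow Y B)
    {t b a₀ a₁ b₀ b₁ : ℤ} (hbound : ∀ p ∈ B, b ≤ p.2 ∧ p.2 ≤ t) (ha : a₀ ≤ a₁)
    (htop : ∀ x, (x, t) ∈ B ↔ a₀ ≤ x ∧ x ≤ a₁) (hbot : ∀ x, (x, b) ∈ B ↔ b₀ ≤ x ∧ x ≤ b₁)
    (hle : a₁ - a₀ ≤ b₁ - b₀)
    {d d' : Configuration A} (hd : d ∈ Y) (hd' : d' ∈ Y)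
    (hag : ∀ p : ℤ × ℤ, p.2 < 0 → d p = d' p) (hne : d 0 ≠ d' 0) :
    ∃ c ∈ Y, ∃ t : ℤ × ℤ, t ≠ 0 ∧ ∀ p, c (p + t) = c p := by
  have hB' := hB.translate hY (-a₀, -t)
  have hbt : b ≤ t := ((hbound _ ((htop a₀).2 ⟨le_rfl, ha⟩)).1)
  have hmem : ∀ p : ℤ × ℤ, p ∈ (B.image fun p => AddEquiv.refl (ℤ × ℤ) p + (-a₀, -t)) ↔
      (p.1 + a₀, p.2 + t) ∈ B := by
    intro p
    rw [Finset.mem_image]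
    constructor
    · rintro ⟨p, hp, rfl⟩; simpa using hp
    · intro h; exact ⟨_, h, by ext <;> simp⟩
  obtain ⟨l, hl⟩ := hB'.exists_generator (h := (t - b).toNat) (m := (a₁ - a₀).toNat)
    (b := b₀ - a₀)
    (fun p hp => by have := (hbound _ ((hmem p).1 hp)).2; simp only at this; omega)
    (fun x => by rw [hmem, zero_add, htop]; omega)
    (fun p hp => by have := (hbound _ ((hmem p).1 hp)).1; simp only at this; omega)
    (by
      rw [hmem]
      simp only
      rw [show -((t - b).toNat : ℤ) + t = b by omega, hbot]; omega)
    (by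
      rw [hmem]
      simp only
      rw [show -((t - b).toNat : ℤ) + t = b by omega, hbot]; omega)
  exact hl.exists_periodic hY hd hd' hag hne

/-- The reflection of `ℤ²` at the horizontal axis. -/
def reflection : ℤ × ℤ ≃+ ℤ × ℤ := (AddEquiv.refl ℤ).prodCongr (AddEquiv.neg ℤ)

theorem reflection_apply (p : ℤ × ℤ) : reflection p = (p.1, -p.2) := rfl

theorem reflection_symm_apply (p : ℤ × ℤ) : reflection.symm p = (p.1, -p.2) := rfl

/-- Which of the extreme rows of `B` is longer is unknown; a reflection exchanges them, and it also
exchanges the two pairs, so both are needed. -/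
theorem IsMinimalLow.exists_periodic (hY : IsSubshift Y) (hB : IsMinimalLow Y B)
    {d d' : Configuration A} (hd : d ∈ Y) (hd' : d' ∈ Y)
    (hag : ∀ p : ℤ × ℤ, p.2 < 0 → d p = d' p) (hne : d 0 ≠ d' 0)
    {e e' : Configuration A} (he : e ∈ Y) (he' : e' ∈ Y)
    (hag' : ∀ p : ℤ × ℤ, 0 < p.2 → e p = e' p) (hne' : e 0 ≠ e' 0) :
    ∃ c ∈ Y, ∃ t : ℤ × ℤ, t ≠ 0 ∧ ∀ p, c (p + t) = c p := by
  obtain ⟨p, hp, hpmax⟩ := B.exists_max_image Prod.snd (hB.nonempty hY.nonempty)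
  obtain ⟨q, hq, hqmin⟩ := B.exists_min_image Prod.snd (hB.nonempty hY.nonempty)
  obtain ⟨a₀, a₁, ha, htop⟩ := hB.convex.exists_row hp
  obtain ⟨b₀, b₁, hb, hbot⟩ := hB.convex.exists_row hq
  rcases le_total (a₁ - a₀) (b₁ - b₀) with hle | hle
  · exact hB.exists_periodic_of_top_le_bottom hY (fun r hr => ⟨hqmin r hr, hpmax r hr⟩) ha htop hbot
      hle hd hd' hag hne
  · have hmem : ∀ p : ℤ × ℤ, p ∈ (B.image fun p => reflection.symm p + 0) ↔ (p.1, -p.2) ∈ B := by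
      intro p
      rw [Finset.mem_image]
      constructor
      · rintro ⟨p, hp, rfl⟩
        simpa [reflection_symm_apply] using hp
      · intro h
        exact ⟨_, h, by ext <;> simp [reflection_symm_apply]⟩
    obtain ⟨_, ⟨c, hc, rfl⟩, t, ht, hct⟩ :=
      (hB.comp reflection).exists_periodic_of_top_le_bottom (hY.comp reflection)
        (t := -q.2) (b := -p.2)
        (fun r hr => by
          have h1 := hqmin _ ((hmem r).1 hr)
          have h2 := hpmax _ ((hmem r).1 hr)
          simp only at h1 h2
          omega) hb (fun x => by rw [hmem, neg_neg, hbot])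
        (fun x => by rw [hmem, neg_neg, htop]) hle ⟨e, he, rfl⟩ ⟨e', he', rfl⟩
        (fun p hp => hag' _ (by rw [reflection_apply]; simpa using hp)) (by simpa using hne')
    refine ⟨c, hc, reflection t, by simpa using ht, fun p => ?_⟩
    have := hct (reflection.symm p)
    simpa using this

end MinimalLow

/-! ### Change of basis and conclusion -/

/-- Every integer vector is a multiple of the first vector of a basis of `ℤ²`. -/
theorem exists_basis_of_ne_zero {v : ℤ × ℤ} (hv : v ≠ 0) :
    ∃ (φ : ℤ × ℤ ≃+ ℤ × ℤ) (k : ℤ), v = k • φ (1, 0) := by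
  obtain ⟨x, y⟩ := v
  have hg : (Int.gcd x y : ℤ) ≠ 0 := by
    intro h
    obtain ⟨hx, hy⟩ := Int.gcd_eq_zero_iff.1 (Int.natCast_eq_zero.1 h)
    exact hv (by rw [hx, hy]; rfl)
  obtain ⟨a, ha⟩ := Int.gcd_dvd_left x y
  obtain ⟨b, hb⟩ := Int.gcd_dvd_right x y
  have hbez : a * Int.gcdA x y + b * Int.gcdB x y = 1 := by
    have h := Int.gcd_eq_gcd_ab x y
    apply mul_left_cancel₀ hg
    calc _ = (Int.gcd x y * a) * Int.gcdA x y + (Int.gcd x y * b) * Int.gcdB x y := by ring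
      _ = _ := by rw [← ha, ← hb, ← h, mul_one]
  generalize Int.gcdA x y = r at hbez
  generalize Int.gcdB x y = s at hbez
  -- The basis is $(a,b)$, the primitive vector along $v$, and $(-s,r)$, of determinant $ar+bs=1$ by
  -- Bézout.
  refine ⟨{ toFun := fun p => (p.1 * a - p.2 * s, p.1 * b + p.2 * r)
            invFun := fun q => (q.1 * r + q.2 * s, q.2 * a - q.1 * b)
            left_inv := fun p => ?_
            right_inv := fun q => ?_
            map_add' := fun p q => ?_ }, Int.gcd x y, ?_⟩
  · ext
    · simp only; linear_combination p.1 * hbez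
    · simp only; linear_combination p.2 * hbez
  · ext
    · simp only; linear_combination q.1 * hbez
    · simp only; linear_combination q.2 * hbez
  · ext <;> simp only [Prod.fst_add, Prod.snd_add] <;> ring
  · ext
    · simpa using ha
    · simpa using hb

theorem exists_basis_of_dotHom_eq_zero {u : ℝ × ℝ} (hu : u ≠ 0) {v : ℤ × ℤ} (hv : v ≠ 0)
    (huv : dotHom u v = 0) :
    ∃ (φ : ℤ × ℤ ≃+ ℤ × ℤ) (r : ℝ), 0 < r ∧ ∀ p, dotHom u (φ p) = p.2 * r := by
  obtain ⟨φ, k, hk⟩ := exists_basis_of_ne_zero hv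
  have hk0 : k ≠ 0 := by rintro rfl; exact hv (by rw [hk, zero_smul])
  have h1 : dotHom u (φ (1, 0)) = 0 := by
    rw [hk, map_zsmul, smul_eq_zero] at huv
    exact huv.resolve_left hk0
  have h2 : ∀ p, dotHom u (φ p) = p.2 * dotHom u (φ (0, 1)) := by
    intro p
    have hp : p = p.1 • ((1 : ℤ), (0 : ℤ)) + p.2 • ((0 : ℤ), (1 : ℤ)) := by ext <;> simp
    conv_lhs => rw [hp]
    rw [map_add, map_zsmul, map_zsmul, map_add, map_zsmul, map_zsmul, h1, smul_zero, zero_add,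
      zsmul_eq_mul]
  have h3 : dotHom u (φ (0, 1)) ≠ 0 := by
    intro h
    have h4 : ∀ q, dotHom u q = 0 := fun q => by
      have := h2 (φ.symm q)
      rwa [φ.apply_symm_apply, h, mul_zero] at this
    refine hu (Prod.ext ?_ ?_)
    · simpa [dotHom] using h4 (1, 0)
    · simpa [dotHom] using h4 (0, 1)
  rcases lt_or_gt_of_ne h3 with h | h
  · refine ⟨reflection.trans φ, -dotHom u (φ (0, 1)), neg_pos.2 h, fun p => ?_⟩
    rw [AddEquiv.trans_apply, reflection_apply, h2]
    push_cast; ring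
  · exact ⟨φ, _, h, h2⟩

theorem exists_common_multiple (L : List (ℤ × ℤ)) (hL : 0 ∉ L) (φ : ℤ × ℤ ≃+ ℤ × ℤ) :
    ∃ W : ℕ, 0 < W ∧ ∀ v ∈ L, (φ.symm v).2 = 0 → ∃ k : ℤ, φ ((W : ℤ), 0) = k • v := by
  induction L with
  | nil => exact ⟨1, one_pos, by simp⟩
  | cons v L ih =>
    obtain ⟨W, hW, h⟩ := ih fun h0 => hL (List.mem_cons_of_mem v h0)
    have hmul : ∀ j : ℕ, φ (((j * W : ℕ) : ℤ), 0) = (j : ℤ) • φ ((W : ℤ), 0) := by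
      intro j
      rw [← map_zsmul]
      simp
    by_cases hv : (φ.symm v).2 = 0
    · have hv0 : (φ.symm v).1 ≠ 0 := by
        intro h0
        have h1 : φ.symm v = 0 := Prod.ext h0 hv
        rw [EmbeddingLike.map_eq_zero_iff] at h1
        exact hL (h1 ▸ List.mem_cons_self)
      refine ⟨(φ.symm v).1.natAbs * W, mul_pos (Int.natAbs_pos.2 hv0) hW, ?_⟩
      intro w hw hw0
      rcases List.mem_cons.1 hw with rfl | hw
      · refine ⟨(φ.symm w).1.sign * W, ?_⟩
        apply φ.symm.injective
        rw [φ.symm_apply_apply, map_zsmul]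
        ext
        · simp only [Prod.smul_fst, smul_eq_mul, Nat.cast_mul, Int.natCast_natAbs]
          rw [← Int.sign_mul_self_eq_abs]; ring
        · simp [hw0]
      · obtain ⟨k, hk⟩ := h w hw hw0
        exact ⟨(φ.symm v).1.natAbs * k, by rw [hmul, hk, smul_smul]⟩
    · refine ⟨W, hW, fun w hw hw0 => ?_⟩
      rcases List.mem_cons.1 hw with rfl | hw
      · exact absurd hw0 hv
      · exact h w hw hw0

/-- A minimal subshift with few patterns on some convex shape that is annihilated by a product of
differences contains a periodic configuration. -/
theorem exists_periodic_of_minimal {A : Type*} [Finite A] {ι : A → ℤ} (hι : Function.Injective ι)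
    {Y : Set (Configuration A)} (hY : IsSubshift Y) (hmin : ∀ Z ⊆ Y, IsSubshift Z → Z = Y)
    {L : List (ℤ × ℤ)} (hL0 : 0 ∉ L) (hL : ∀ c ∈ Y, diffs L (fun p => ι (c p)) = 0)
    {D : Finset (ℤ × ℤ)} (hD : LatticeConvex D) (hlow : patternCount Y D ≤ D.card) :
    ∃ c ∈ Y, ∃ t : ℤ × ℤ, t ≠ 0 ∧ ∀ p, c (p + t) = c p := by
  rcases Y.finite_or_infinite with hfin | hinf
  · obtain ⟨c, hc⟩ := hY.nonempty
    exact ⟨c, hc, hY.exists_period_of_finite hfin hc⟩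
  obtain ⟨u, hu, z, hz, z', hz', hne, hag⟩ := exists_ne_agree_on_halfPlane hY hinf
  set g : ℤ × ℤ → ℤ := (fun p => ι (z p)) - fun p => ι (z' p) with hg
  have hgL : diffs L g = 0 := by rw [hg, diffs_sub, hL z hz, hL z' hz', sub_zero]
  have hg0 : ∀ p, dotHom u p < 0 → g p = 0 := fun p hp => by simp [hg, hag p hp]
  -- Were all differences transversal, `g` would vanish, contrary to the disagreement at the origin.
  obtain ⟨v, hvL, huv⟩ : ∃ v ∈ L, dotHom u v = 0 := by
    by_contra! hcon
    have h := congrFun (eq_zero_of_halfPlane (dotHom u) L hcon hg0 hgL) 0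
    exact hne (hι (sub_eq_zero.1 h))
  obtain ⟨φ, r, hr, hφ⟩ := exists_basis_of_dotHom_eq_zero hu
    (ne_of_mem_of_not_mem hvL hL0) huv
  obtain ⟨W, hW, hWL⟩ := exists_common_multiple L hL0 φ
  obtain ⟨C, hC⟩ : ∃ C : ℤ, ∀ p, |g p| ≤ C := by
    obtain ⟨C, hC⟩ := (Set.finite_range fun b : A × A => |ι b.1 - ι b.2|).bddAbove
    exact ⟨C, fun p => hC ⟨(z p, z' p), rfl⟩⟩
  have hgW : diff (φ ((W : ℤ), 0)) g = 0 := by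
    refine diff_eq_zero_of_halfPlane (dotHom u) L _ (fun w hw hw0 => hWL w hw ?_) hC hg0 hgL
    have h := hφ (φ.symm w)
    rw [φ.apply_symm_apply, hw0] at h
    exact_mod_cast (mul_eq_zero.1 h.symm).resolve_right hr.ne'
  have hper : PeriodicDifference ι W (z ∘ φ) (z' ∘ φ) := by
    intro p
    have h := sub_eq_zero.1 (congrFun hgW (φ p))
    rw [← map_add] at h
    exact h
  have hag' : ∀ p : ℤ × ℤ, p.2 < 0 → (z ∘ φ) p = (z' ∘ φ) p := fun p hp => hag _ (by
    rw [hφ]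
    exact mul_neg_of_neg_of_pos (by exact_mod_cast hp) hr)
  have hne' : (z ∘ φ) 0 ≠ (z' ∘ φ) 0 := by simpa using hne
  have hY' := hY.comp φ
  obtain ⟨e, he, e', he', heag, hene⟩ := exists_pair_agree_above hι hW hY' (minimal_comp hmin φ)
    ⟨z, hz, rfl⟩ ⟨z', hz', rfl⟩ hper (fun h => hne' (congrFun h 0)) hag'
  obtain ⟨B, hB⟩ := exists_isMinimalLow hD hlow
  obtain ⟨_, ⟨c, hc, rfl⟩, t, ht, hct⟩ := (hB.comp φ).exists_periodic hY' ⟨z, hz, rfl⟩ ⟨z', hz', rfl⟩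
    hag' hne' he he' heag hene
  refine ⟨c, hc, φ t, by simpa using ht, fun p => ?_⟩
  simpa using hct (φ.symm p)

end LowComplexity

theorem corollary1 {A : Type*} [Finite A] (n m : ℕ)
    (P : Set (LowComplexity.Pattern A (LowComplexity.rectangle n m)))
    (hP : P.ncard ≤ n * m) (hX : (LowComplexity.allowedSFT P).Nonempty) :
    ∃ c ∈ LowComplexity.allowedSFT P, LowComplexity.IsPeriodic c := by
  obtain ⟨ι, hι⟩ : ∃ ι : A → ℤ, Function.Injective ι := by
    obtain ⟨k, ⟨f⟩⟩ := Finite.exists_equiv_fin A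
    exact ⟨fun a => (f a : ℕ), fun a b h => f.injective (Fin.ext (Int.ofNat_inj.1 h))⟩
  have hcard : (LowComplexity.rectangle n m).card = n * m := by
    simp [LowComplexity.rectangle]
  rw [← hcard] at hP
  obtain ⟨L, hL0, hL⟩ := LowComplexity.exists_diffs_eq_zero_of_ncard_le ι P hP
  obtain ⟨Y, hYX, hY, hmin⟩ := LowComplexity.exists_minimal_subshift
    (LowComplexity.isSubshift_allowedSFT hX)
  have hlow : LowComplexity.patternCount Y (LowComplexity.rectangle n m)
      ≤ (LowComplexity.rectangle n m).card := by
    refine le_trans (Set.ncard_le_ncard ?_ P.toFinite) hP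
    rintro _ ⟨c, hc, rfl⟩
    refine hYX hc ⟨0, ?_⟩
    funext d
    simp [LowComplexity.restrict, LowComplexity.translate]
  obtain ⟨c, hc, t, ht, hct⟩ := LowComplexity.exists_periodic_of_minimal hι hY hmin hL0
    (fun c hc => hL c (hYX hc)) (LowComplexity.latticeConvex_rectangle n m) hlow
  refine ⟨c, hYX hc, t, ht, ?_⟩
  funext p
  have h := hct (p - t)
  rw [sub_add_cancel] at h
  exact h.symm
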